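/- A rational Diophantine $k$-tuple is a set of $k$ distinct nonzero rational numbers such that the product of any two distinct elements, increased by $1$, is the square of a rational number. Let $t\in\mathbb{Q}\setminus\{-1,0,1\}$, let $$E:\quad y^2=x^3+3(t^2-3t+1)(t^2+3t+1)x^2+3(t^2+1)^4x+(t^2+1)^6,$$ and let $R=[0,(t^2+1)^3]\in E(\mathbb{Q})$. For a point of $E(\mathbb{Q})$ with $x$-coordinate $x\neq 0$ put $$\sigma_3=\frac{t^2-1}{2t},\qquad \sigma_1=\frac{-t^4+4t^2-1-x^{-1}(t^2+1)^4}{(t^2-1)t},\qquad \sigma_2=\frac{\sigma_1^2\sigma_3^2-12\sigma_3^2-6\sigma_1\sigma_3-3}{4+4\sigma_3^2},$$ $$E':\quad Y^2=X^3+\sigma_2X^2+\sigma_1\sigma_3X+\sigma_3^2,$$ $$E'':\quad Y^2=X^3+\frac{((t^2+1)^2x^{-1}+1)^2}{4}X^2+\frac{t^2((t^2+1)^2x^{-2}+x^{-1})}{2}X+\frac{t^4x^{-2}}{4}.$$ Theorem. For every integer $m>1$ the multiple $[m]R$ is an affine point $[x,y]$ with $x\ne 0$, and for the curves associated with this $x$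 the following holds. 1. $E''$ is an elliptic curve with full rational $2$-torsion, that is, $E''(\mathbb{Q})[2]\cong(\mathbb{Z}/2\mathbb{Z})^2$. 2. The corresponding triple is rational: there are $a,b,c\in\mathbb{Q}$ with $X^3-\sigma_1X^2+\sigma_2X-\sigma_3=(X-a)(X-b)(X-c)$. Moreover $\{a,b,c\}$ is a rational Diophantine triple, and $S'=\left[1,\sqrt{(ab+1)(ac+1)(bc+1)}\right]$ is a rational point of $E'$ with $[3]S'=\mathcal{O}$. 3. Let $P'=[0,abc]\in E'(\mathbb{Q})$. For all but finitely many integers $n\ge 0$, with $T=[2n+1]P'$, the set $$\left\{a,b,c,\frac{x(T)}{abc},\frac{x(T+S')}{abc},\frac{x(T-S')}{abc}\right\}$$ is a rational Diophantine sextuple, and infinitely many different rational Diophantine sextuples arise in this way. In particular, infinitely many rational Diophantine sextuples contain $\{a,b,c\}$. -/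

import Mathlib

open Polynomial

namespace DiophantineSextuples

/-- A rational Diophantine `k`-tuple: a set of `k` (distinct) nonzero rationals such that the
product of any two of them, increased by `1`, is the square of a rational number. -/
def IsRationalDiophantineTuple (k : ℕ) (s : Finset ℚ) : Prop :=
  s.card = k ∧ 0 ∉ s ∧ ∀ x ∈ s, ∀ y ∈ s, x ≠ y → IsSquare (x * y + 1)

/-- The curve `E : y² = x³ + 3(t²-3t+1)(t²+3t+1)x² + 3(t²+1)⁴x + (t²+1)⁶`. -/
def curveE (t : ℚ) : WeierstrassCurve.Affine ℚ where
  a₁ := 0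
  a₂ := 3 * (t ^ 2 - 3 * t + 1) * (t ^ 2 + 3 * t + 1)
  a₃ := 0
  a₄ := 3 * (t ^ 2 + 1) ^ 4
  a₆ := (t ^ 2 + 1) ^ 6

theorem nonsingular_R (t : ℚ) : (curveE t).Nonsingular 0 ((t ^ 2 + 1) ^ 3) := by
  rw [WeierstrassCurve.Affine.nonsingular_iff']
  refine ⟨?_, Or.inr ?_⟩
  · rw [WeierstrassCurve.Affine.equation_iff]
    simp only [curveE]
    ring
  · simp only [curveE]
    have h : 0 < (t ^ 2 + 1) ^ 3 := by positivity
    intro h0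
    linarith

/-- The point `R = [0, (t²+1)³]` of `E(ℚ)`. -/
def pointR (t : ℚ) : (curveE t).Point := .some 0 ((t ^ 2 + 1) ^ 3) (nonsingular_R t)

/-- `σ₃ = (t²-1)/(2t)`. -/
def sigma₃ (t : ℚ) : ℚ := (t ^ 2 - 1) / (2 * t)

/-- `σ₁`, as a function of `t` and of the `x`-coordinate of a rational point of `E`. -/
def sigma₁ (t x : ℚ) : ℚ :=
  (-t ^ 4 + 4 * t ^ 2 - 1 - x⁻¹ * (t ^ 2 + 1) ^ 4) / ((t ^ 2 - 1) * t)

/-- `σ₂`, expressed through `σ₁` and `σ₃`. -/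
def sigma₂ (t x : ℚ) : ℚ :=
  (sigma₁ t x ^ 2 * sigma₃ t ^ 2 - 12 * sigma₃ t ^ 2 - 6 * sigma₁ t x * sigma₃ t - 3) /
    (4 + 4 * sigma₃ t ^ 2)

/-- The cubic `X³ - σ₁X² + σ₂X - σ₃` whose roots form the triple `{a, b, c}` associated with a
rational point of `E` with `x`-coordinate `x`. -/
noncomputable def tripleCubic (t x : ℚ) : ℚ[X] :=
  X ^ 3 - C (sigma₁ t x) * X ^ 2 + C (sigma₂ t x) * X - C (sigma₃ t)

/-- The curve `E' : Y² = X³ + σ₂X² + σ₁σ₃X + σ₃²`, i.e. `Y² = (X + ab)(X + ac)(X + bc)`. -/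
def curveE' (t x : ℚ) : WeierstrassCurve.Affine ℚ where
  a₁ := 0
  a₂ := sigma₂ t x
  a₃ := 0
  a₄ := sigma₁ t x * sigma₃ t
  a₆ := sigma₃ t ^ 2

/-- The curve `E''`, given by `Y² = X³ + (((t²+1)²x⁻¹+1)²/4) X² + (t²((t²+1)²x⁻²+x⁻¹)/2) X
+ t⁴x⁻²/4`. -/
def curveE'' (t x : ℚ) : WeierstrassCurve.Affine ℚ where
  a₁ := 0
  a₂ := ((t ^ 2 + 1) ^ 2 * x⁻¹ + 1) ^ 2 / 4
  a₃ := 0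
  a₄ := t ^ 2 * ((t ^ 2 + 1) ^ 2 * x⁻¹ ^ 2 + x⁻¹) / 2
  a₆ := t ^ 4 * x⁻¹ ^ 2 / 4

/-- `W(ℚ)[2] ≅ ℤ/2ℤ × ℤ/2ℤ`. -/
def HasFullRationalTwoTorsion (W : WeierstrassCurve.Affine ℚ) : Prop :=
  Nonempty (AddSubgroup.torsionBy W.Point 2 ≃+ ZMod 2 × ZMod 2)

/-- The `x`-coordinate of a rational point. The value `0` at the point at infinity is harmless in
the sets below, as `0` is never an element of a rational Diophantine tuple. -/
def xCoord {W : WeierstrassCurve.Affine ℚ} : W.Point → ℚ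
  | .zero => 0
  | .some x _ _ => x

/-- The set `{a, b, c, x(T)/abc, x(T+S)/abc, x(T-S)/abc}`. -/
def extendedSet {W : WeierstrassCurve.Affine ℚ} (a b c : ℚ) (T S : W.Point) : Finset ℚ :=
  {a, b, c, xCoord T / (a * b * c), xCoord (T + S) / (a * b * c), xCoord (T - S) / (a * b * c)}

end DiophantineSextuples

namespace DiophantineSextuples

/-! Write s = t² + 1, ab + 1 = A², ac + 1 = B², bc + 1 = C², and let e₁, e₂, e₃ be the elementary
symmetric functions of A, B, C. Putting X = U + 1 turns E' into Y² = (U + A²)(U + B²)(U + C²). If e₂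
= 0 this is Y² = U³ + (e₁U - e₃)², so the points over U = 0, among them S', are flexes. If e₂ = 0
then also (A²-1)(B²-1)(C²-1) = (e₁ + e₃)² - 1, which is σ₃² when e₁ + e₃ = s/(2t); then a, b, c are
recovered rationally from A, B, C.

The equation of E reads y² + 27t²x² = (x + s²)³, with a norm from ℚ(√-3) on the left. If y + 3√-3 t
x = (g + h√-3)³, then A = s/(2h), B = -s/(g+h), C = s/(g-h) satisfy both conditions
(`exists_tripleData`). The point R gives the cube s³, and adding R preserves cubes
(`exists_isCubic_add`). The inequalities x ≠ 0 and y ≠ 0 hold because R has infinite order: [3]R is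
3-adically close to O (`nsmul_pointR_ne_zero`). The curve E'' is E' in the coordinate U, rescaled by
(t/s)².

For the sextuples, a line through U and S' gives x(U)x(U+S') + (abc)² = square
(`xCoord_mul_add_sq`), and 2-descent gives the products with a, b, c, because T and T ± S' all lie
in P' + 2E'(ℚ) (`isSquare_mul_xCoord`). Degenerate cases are finite in number once P' has infinite
order.

That last fact (`nsmul_P_ne_zero`) is the hard part. It rests on the formal group: a point with
non-integral x-coordinate is not torsion. If an odd prime p divides the numerator of t² - 1, then σ₃
≡ 0 and [2]P' is p-adically close to O, unless x ≡ 8 mod p. But (8, 0) is the singular point of E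
mod p, which multiples of R avoid. If there is no such p, then t is a 2-adic unit, and the same is
done at 2 with [2]P', [4]P' or multiples of P' ± S', according to the sizes of a₄ and σ₃. -/

/-- A Weierstrass curve of the form `y² = x³ + a₂x² + a₄x + a₆`. -/
def IsShort (W : WeierstrassCurve.Affine ℚ) : Prop := W.a₁ = 0 ∧ W.a₃ = 0

/-! ### Chord and tangent addition on y² = x³ + a₂x² + a₄x + a₆ -/

section Short

variable {W : WeierstrassCurve.Affine ℚ}

theorem IsShort.equation_iff (hW : IsShort W) (x y : ℚ) :
    W.Equation x y ↔ y ^ 2 = x ^ 3 + W.a₂ * x ^ 2 + W.a₄ * x + W.a₆ := by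
  rw [WeierstrassCurve.Affine.equation_iff, hW.1, hW.2]
  simp

theorem IsShort.negY (hW : IsShort W) (x y : ℚ) : W.negY x y = -y := by
  simp [WeierstrassCurve.Affine.negY, hW.1, hW.2]

theorem IsShort.neg_some (hW : IsShort W) {x y : ℚ} (h : W.Nonsingular x y) :
    ∃ h' : W.Nonsingular x (-y), -(WeierstrassCurve.Affine.Point.some x y h) = .some x (-y) h' := by
  have e := hW.negY x y
  have h' : W.Nonsingular x (-y) := e ▸ (W.nonsingular_neg x y).mpr h
  refine ⟨h', ?_⟩
  rw [WeierstrassCurve.Affine.Point.neg_some]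
  simp only [e]

theorem IsShort.some_add_eq_zero (hW : IsShort W) {x y₁ y₂ : ℚ} (h₁ : W.Nonsingular x y₁)
    (h₂ : W.Nonsingular x y₂) (hy : y₁ = -y₂) :
    WeierstrassCurve.Affine.Point.some x y₁ h₁ + .some x y₂ h₂ = 0 :=
  WeierstrassCurve.Affine.Point.add_of_Y_eq rfl (by rw [hW.negY, hy])

/-- The line `y = Lx + M` meets the curve in three points with `x`-coordinates `x₁, x₂, x₃`. -/
structure LineMeets (W : WeierstrassCurve.Affine ℚ) (L M x₁ x₂ x₃ : ℚ) : Prop where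
  a₂_eq : W.a₂ = L ^ 2 - x₁ - x₂ - x₃
  a₄_eq : W.a₄ = x₁ * x₂ + x₁ * x₃ + x₂ * x₃ + 2 * L * M
  a₆_eq : W.a₆ = M ^ 2 - x₁ * x₂ * x₃

theorem LineMeets.eval {L M x₁ x₂ x₃ : ℚ} (h : LineMeets W L M x₁ x₂ x₃) (x : ℚ) :
    x ^ 3 + W.a₂ * x ^ 2 + W.a₄ * x + W.a₆ = (x - x₁) * (x - x₂) * (x - x₃) + (L * x + M) ^ 2 := by
  rw [h.a₂_eq, h.a₄_eq, h.a₆_eq]; ring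

/-- The last conjunct is the difference of the two curve equations divided by x₁ - x₂. In this form
it also determines the slope of the tangent when the points coincide, so chords and tangents are
treated together from here on. -/
theorem IsShort.exists_line (hW : IsShort W) {x₁ y₁ x₂ y₂ : ℚ} (h₁ : W.Nonsingular x₁ y₁)
    (h₂ : W.Nonsingular x₂ y₂) (hxy : ¬(x₁ = x₂ ∧ y₁ = -y₂)) :
    ∃ (L M x₃ y₃ : ℚ) (h₃ : W.Nonsingular x₃ y₃),
      WeierstrassCurve.Affine.Point.some x₁ y₁ h₁ + .some x₂ y₂ h₂ = .some x₃ y₃ h₃ ∧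
      y₁ = L * x₁ + M ∧ y₂ = L * x₂ + M ∧ -y₃ = L * x₃ + M ∧ LineMeets W L M x₁ x₂ x₃ ∧
      L * (y₁ + y₂) = x₁ ^ 2 + x₁ * x₂ + x₂ ^ 2 + W.a₂ * (x₁ + x₂) + W.a₄ := by
  have hxy' : ¬(x₁ = x₂ ∧ y₁ = W.negY x₂ y₂) := by rwa [hW.negY]
  have e₁ := (hW.equation_iff _ _).mp h₁.1
  have e₂ := (hW.equation_iff _ _).mp h₂.1
  set L := W.slope x₁ x₂ y₁ y₂ with hL
  have hM₂ : y₂ = L * x₂ + (y₁ - L * x₁) := by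
    by_cases hx : x₁ = x₂
    · have hy : y₁ = y₂ := by
        have : (y₁ - y₂) * (y₁ + y₂) = 0 := by subst hx; linear_combination e₁ - e₂
        rcases mul_eq_zero.mp this with h | h
        · linarith
        · exact absurd ⟨hx, by linarith⟩ hxy
      rw [hx, hy]; ring
    · rw [hL, WeierstrassCurve.Affine.slope_of_X_ne hx]
      have : x₁ - x₂ ≠ 0 := sub_ne_zero.mpr hx
      field_simp
      ring
  have hsum : L * (y₁ + y₂) = x₁ ^ 2 + x₁ * x₂ + x₂ ^ 2 + W.a₂ * (x₁ + x₂) + W.a₄ := by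
    by_cases hx : x₁ = x₂
    · have hy : y₁ = y₂ := by rw [hM₂, hx]; ring
      have hy0 : y₁ ≠ W.negY x₂ y₂ := fun h => hxy' ⟨hx, h⟩
      have hy1 : y₁ - W.negY x₁ y₁ ≠ 0 := by
        rw [hW.negY]; rw [hW.negY] at hy0; intro h; exact hy0 (by linarith)
      rw [hL, WeierstrassCurve.Affine.slope_of_Y_ne hx hy0, hW.1]
      rw [hW.negY] at hy1 ⊢
      subst hx; subst hy
      have hy2 : y₁ ≠ 0 := by rintro rfl; simp at hy1
      field_simp
      ring
    · have : x₁ - x₂ ≠ 0 := sub_ne_zero.mpr hx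
      apply mul_left_cancel₀ this
      have : (x₁ - x₂) * L = y₁ - y₂ := by rw [hM₂]; ring
      linear_combination (y₁ + y₂) * this + e₁ - e₂
  have hx₃ : W.addX x₁ x₂ L = L ^ 2 - W.a₂ - x₁ - x₂ := by
    simp [WeierstrassCurve.Affine.addX, hW.1]
  refine ⟨L, y₁ - L * x₁, _, _, W.nonsingular_add h₁ h₂ hxy',
    WeierstrassCurve.Affine.Point.add_some hxy', by ring, hM₂, ?_, ⟨?_, ?_, ?_⟩, hsum⟩
  · rw [WeierstrassCurve.Affine.addY, hW.negY, WeierstrassCurve.Affine.negAddY, ← hL]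
    ring
  · rw [hx₃]; ring
  · rw [hx₃]
    linear_combination (-1) * hsum + L * hM₂
  · rw [hx₃]
    linear_combination (-1) * e₁ + x₁ * (hsum - L * hM₂)

end Short

/-! ### Ultrametric estimates -/

section PadicNorm

variable {p : ℕ} [Fact p.Prime] {a b r s : ℚ}

theorem padicNorm_add_le (ha : padicNorm p a ≤ r) (hb : padicNorm p b ≤ r) :
    padicNorm p (a + b) ≤ r :=
  padicNorm.nonarchimedean.trans (max_le ha hb)

theorem padicNorm_sub_le (ha : padicNorm p a ≤ r) (hb : padicNorm p b ≤ r) :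
    padicNorm p (a - b) ≤ r :=
  padicNorm.sub.trans (max_le ha hb)

theorem padicNorm_mul_le (ha : padicNorm p a ≤ r) (hb : padicNorm p b ≤ s) :
    padicNorm p (a * b) ≤ r * s := by
  rw [padicNorm.mul]
  exact mul_le_mul ha hb (padicNorm.nonneg _) ((padicNorm.nonneg _).trans ha)

theorem padicNorm_pow (a : ℚ) (n : ℕ) : padicNorm p (a ^ n) = padicNorm p a ^ n := by
  induction n with
  | zero => simp
  | succ k ih => rw [pow_succ, padicNorm.mul, ih, pow_succ]

theorem padicNorm_pow_le (ha : padicNorm p a ≤ r) (n : ℕ) : padicNorm p (a ^ n) ≤ r ^ n := by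
  rw [padicNorm_pow]
  exact pow_le_pow_left₀ (padicNorm.nonneg _) ha n

theorem padicNorm_add_eq_of_lt (h : padicNorm p b < padicNorm p a) :
    padicNorm p (a + b) = padicNorm p a := by
  rw [padicNorm.add_eq_max_of_ne h.ne', max_eq_left h.le]

theorem padicNorm_sub_eq_of_lt (h : padicNorm p b < padicNorm p a) :
    padicNorm p (a - b) = padicNorm p a := by
  rw [sub_eq_add_neg]
  exact padicNorm_add_eq_of_lt (by rwa [padicNorm.neg])

theorem padicNorm_pos (ha : a ≠ 0) : 0 < padicNorm p a :=
  (padicNorm.nonneg a).lt_of_ne' (padicNorm.nonzero ha)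

/-- A rational number of norm less than `1` has norm at most `1/p`. -/
theorem padicNorm_le_inv_of_lt_one (ha : padicNorm p a < 1) : padicNorm p a ≤ (p : ℚ)⁻¹ := by
  have hp1 : (1 : ℚ) < p := mod_cast (Fact.out : p.Prime).one_lt
  by_cases h0 : a = 0
  · simp [h0]
  · obtain ⟨z, hz⟩ := padicNorm.values_discrete (p := p) h0
    rw [hz] at ha ⊢
    rw [← zpow_neg_one]
    have : (p : ℚ) ^ (-z) < (p : ℚ) ^ (0 : ℤ) := by simpa using ha
    rw [zpow_lt_zpow_iff_right₀ hp1] at this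
    exact zpow_le_zpow_right₀ hp1.le (by omega)

theorem inv_le_padicNorm_natCast_prime {l : ℕ} (hl : l.Prime) :
    (p : ℚ)⁻¹ ≤ padicNorm p (l : ℚ) := by
  have hp1 : (1 : ℚ) < p := mod_cast (Fact.out : p.Prime).one_lt
  by_cases h : p = l
  · subst h
    rw [padicNorm.padicNorm_p_of_prime]
  · have := Fact.mk hl
    rw [padicNorm.padicNorm_of_prime_of_ne h]
    exact inv_le_one_of_one_le₀ hp1.le

theorem padicNorm_two_of_odd_prime (hp : p ≠ 2) : padicNorm p (2 : ℚ) = 1 := by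
  have := Fact.mk Nat.prime_two
  exact_mod_cast padicNorm.padicNorm_of_prime_of_ne (p := p) (q := 2) hp

end PadicNorm

/-! ### The formal group: points near infinity have infinite order -/

section FormalGroup

variable {p : ℕ} [Fact p.Prime]

set_option maxHeartbeats 1000000 in
/-- Estimates, in the coordinates `z = X / Y`, `w = 1 / Y`, for three collinear points near the
point at infinity. -/
theorem collinear_near_infinity {L M X₁ X₂ X₃ b₂ b₄ b₆ r : ℚ}
    (h₂ : b₂ = L ^ 2 - X₁ - X₂ - X₃) (h₄ : b₄ = X₁ * X₂ + X₁ * X₃ + X₂ * X₃ + 2 * L * M)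
    (h₆ : b₆ = M ^ 2 - X₁ * X₂ * X₃)
    (n₂ : padicNorm p b₂ ≤ 1) (n₄ : padicNorm p b₄ ≤ 1) (n₆ : padicNorm p b₆ ≤ 1) (hr : r < 1)
    (y₁ : L * X₁ + M ≠ 0) (y₂ : L * X₂ + M ≠ 0)
    (hz₁ : padicNorm p (X₁ / (L * X₁ + M)) ≤ r) (hw₁ : padicNorm p (1 / (L * X₁ + M)) ≤ r ^ 3)
    (hz₂ : padicNorm p (X₂ / (L * X₂ + M)) ≤ r) (hw₂ : padicNorm p (1 / (L * X₂ + M)) ≤ r ^ 3) :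
    L * X₃ + M ≠ 0 ∧ padicNorm p (X₃ / (L * X₃ + M)) ≤ r ∧
      padicNorm p (1 / (L * X₃ + M)) ≤ r ^ 3 ∧
      padicNorm p (X₁ / (L * X₁ + M) + X₂ / (L * X₂ + M) + X₃ / (L * X₃ + M)) ≤ r ^ 3 := by
  have hr0 : 0 ≤ r := (padicNorm.nonneg _).trans hz₁
  have r1 : r ^ 2 ≤ 1 := pow_le_one₀ hr0 hr.le
  have r2 : r ^ 2 < 1 := pow_lt_one₀ hr0 hr two_ne_zero
  have r3 : r ^ 3 ≤ r ^ 2 := by nlinarith [sq_nonneg r]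
  have r31 : r ^ 3 ≤ r := by nlinarith
  have r4 : r ^ 3 * r ≤ r ^ 2 := by nlinarith [pow_nonneg hr0 3]
  have r22 : (r ^ 2) ^ 2 ≤ 1 := pow_le_one₀ (sq_nonneg r) r1
  have r6 : (r ^ 3) ^ 2 ≤ r ^ 2 := by nlinarith [pow_nonneg hr0 3]
  set z₁ := X₁ / (L * X₁ + M) with hz₁'
  set z₂ := X₂ / (L * X₂ + M) with hz₂'
  set w₁ := 1 / (L * X₁ + M) with hw₁'
  set w₂ := 1 / (L * X₂ + M) with hw₂'
  -- The curve is w = z³ + b₂z²w + b₄zw² + b₆w³. Subtracting its equations at the two points and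
  -- dividing by z₁ - z₂ gives the slope of the (z, w)-line as a quotient with this numerator and
  -- the denominator estimated next; the quotient makes sense for tangents too.
  have nN : padicNorm p (z₁ ^ 2 + z₁ * z₂ + z₂ ^ 2 + b₂ * (w₁ * (z₁ + z₂)) + b₄ * w₁ ^ 2) ≤ r ^ 2 := by
    have e1 := padicNorm_pow_le hz₁ 2
    have e2 := padicNorm_pow_le hz₂ 2
    have e3 := padicNorm_mul_le hz₁ hz₂
    have e4 := padicNorm_mul_le n₂ (padicNorm_mul_le hw₁ (padicNorm_add_le hz₁ hz₂))
    have e5 := padicNorm_mul_le n₄ (padicNorm_pow_le hw₁ 2)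
    refine padicNorm_add_le (padicNorm_add_le (padicNorm_add_le (padicNorm_add_le e1 ?_) e2) ?_) ?_
    · exact e3.trans (le_of_eq (by ring))
    · exact e4.trans (by linarith)
    · exact e5.trans (by linarith)
  have nD : padicNorm p (1 - (b₂ * z₂ ^ 2 + b₄ * (z₂ * (w₁ + w₂)) +
      b₆ * (w₁ ^ 2 + w₁ * w₂ + w₂ ^ 2))) = 1 := by
    have e1 := padicNorm_mul_le n₂ (padicNorm_pow_le hz₂ 2)
    have e2 := padicNorm_mul_le n₄ (padicNorm_mul_le hz₂ (padicNorm_add_le hw₁ hw₂))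
    have e3 := padicNorm_mul_le n₆ (padicNorm_add_le (padicNorm_add_le (padicNorm_pow_le hw₁ 2)
      ((padicNorm_mul_le hw₁ hw₂).trans (by rw [← sq]))) (padicNorm_pow_le hw₂ 2))
    rw [padicNorm_sub_eq_of_lt, padicNorm.one]
    rw [padicNorm.one]
    refine lt_of_le_of_lt (padicNorm_add_le (padicNorm_add_le (e1.trans ?_) (e2.trans ?_))
      (e3.trans ?_)) r2
    · linarith
    · rw [one_mul, mul_comm]; exact r4
    · linarith
  have hLD : -L * (1 - (b₂ * z₂ ^ 2 + b₄ * (z₂ * (w₁ + w₂)) + b₆ * (w₁ ^ 2 + w₁ * w₂ + w₂ ^ 2))) =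
      M * (z₁ ^ 2 + z₁ * z₂ + z₂ ^ 2 + b₂ * (w₁ * (z₁ + z₂)) + b₄ * w₁ ^ 2) := by
    rw [hz₁', hz₂', hw₁', hw₂', h₂, h₄, h₆]
    field_simp
    ring
  set N := z₁ ^ 2 + z₁ * z₂ + z₂ ^ 2 + b₂ * (w₁ * (z₁ + z₂)) + b₄ * w₁ ^ 2
  set D := 1 - (b₂ * z₂ ^ 2 + b₄ * (z₂ * (w₁ + w₂)) + b₆ * (w₁ ^ 2 + w₁ * w₂ + w₂ ^ 2))
  have hD : D ≠ 0 := by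
    intro h; rw [h] at nD; simp at nD
  have hM : M ≠ 0 := by
    rintro rfl
    have : L = 0 := by simpa [hD] using hLD
    simp [this] at y₁
  set lam := -L / M with hlam
  set nu := 1 / M with hnu
  have nlam : padicNorm p lam ≤ r ^ 2 := by
    have : lam = N / D := by
      rw [hlam, div_eq_div_iff hM hD, hLD]; ring
    rw [this, padicNorm.div, nD, div_one]
    exact nN
  have hnu' : nu = w₁ - lam * z₁ := by
    rw [hnu, hlam, hw₁', hz₁']
    field_simp
    ring
  have nnu : padicNorm p nu ≤ r ^ 3 := by
    rw [hnu']
    refine padicNorm_sub_le hw₁ ((padicNorm_mul_le nlam hz₁).trans (le_of_eq (by ring)))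
  -- Substituting w = λz + ν into the curve gives a cubic in z with this unit as leading
  -- coefficient. Its z²-coefficient is a multiple of ν, whence the bound r³ for the sum of the
  -- roots.
  have nA : padicNorm p (1 + lam * (b₂ + b₄ * lam + b₆ * lam ^ 2)) = 1 := by
    rw [padicNorm_add_eq_of_lt, padicNorm.one]
    rw [padicNorm.one]
    have e1 : padicNorm p (b₄ * lam) ≤ 1 := (padicNorm_mul_le n₄ nlam).trans (by linarith)
    have e2 : padicNorm p (b₆ * lam ^ 2) ≤ 1 :=
      (padicNorm_mul_le n₆ (padicNorm_pow_le nlam 2)).trans (by linarith)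
    exact lt_of_le_of_lt (padicNorm_mul_le nlam (padicNorm_add_le (padicNorm_add_le n₂ e1) e2))
      (by linarith)
  set A := 1 + lam * (b₂ + b₄ * lam + b₆ * lam ^ 2) with hA
  have hA0 : A ≠ 0 := by
    intro h; rw [h] at nA; simp at nA
  have hY₃ : (L * X₁ + M) * (L * X₂ + M) * (L * X₃ + M) = A * M ^ 3 := by
    rw [hA, hlam, h₂, h₄, h₆]
    field_simp
    ring
  have y₃ : L * X₃ + M ≠ 0 := by
    intro h
    rw [h, mul_zero] at hY₃
    exact mul_ne_zero hA0 (pow_ne_zero 3 hM) hY₃.symm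
  set z₃ := X₃ / (L * X₃ + M) with hz₃'
  have hsum : z₁ + z₂ + z₃ = -(nu * (b₂ + 2 * (b₄ * lam) + 3 * (b₆ * lam ^ 2))) / A := by
    have h1 : z₁ + z₂ + z₃ = -(M ^ 2 * b₂ - 2 * b₄ * L * M + 3 * b₆ * L ^ 2) / (A * M ^ 3) := by
      rw [← hY₃, hz₁', hz₂', hz₃', div_add_div _ _ y₁ y₂, div_add_div _ _ (mul_ne_zero y₁ y₂) y₃]
      congr 1
      rw [h₂, h₄, h₆]
      ring
    rw [h1, hlam, hnu]
    field_simp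
    ring
  have nsum : padicNorm p (z₁ + z₂ + z₃) ≤ r ^ 3 := by
    rw [hsum, padicNorm.div, nA, div_one, padicNorm.neg]
    have t2 : padicNorm p 2 ≤ 1 := mod_cast padicNorm.of_nat (p := p) 2
    have t3 : padicNorm p 3 ≤ 1 := mod_cast padicNorm.of_nat (p := p) 3
    have e1 : padicNorm p (2 * (b₄ * lam)) ≤ 1 :=
      (padicNorm_mul_le t2 (padicNorm_mul_le n₄ nlam)).trans (by linarith)
    have e2 : padicNorm p (3 * (b₆ * lam ^ 2)) ≤ 1 :=
      (padicNorm_mul_le t3 (padicNorm_mul_le n₆ (padicNorm_pow_le nlam 2))).trans (by nlinarith)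
    exact (padicNorm_mul_le nnu (padicNorm_add_le (padicNorm_add_le n₂ e1) e2)).trans
      (le_of_eq (mul_one _))
  have nz₃ : padicNorm p z₃ ≤ r := by
    have : z₃ = (z₁ + z₂ + z₃) - (z₁ + z₂) := by ring
    rw [this]
    exact padicNorm_sub_le (nsum.trans r31) (padicNorm_add_le hz₁ hz₂)
  refine ⟨y₃, nz₃, ?_, nsum⟩
  have : 1 / (L * X₃ + M) = lam * z₃ + nu := by
    rw [hlam, hnu, hz₃']
    field_simp
    ring
  rw [this]
  exact padicNorm_add_le ((padicNorm_mul_le nlam nz₃).trans (le_of_eq (by ring))) nnu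

variable {W : WeierstrassCurve.Affine ℚ}

/-- The local parameter `x / (c y)` at infinity, for coordinates rescaled by `c`. -/
def zCoord (c : ℚ) : W.Point → ℚ
  | .zero => 0
  | .some x y _ => x / (c * y)

/-- The point lies in the neighbourhood of radius `r` of the point at infinity. -/
def NearInfinity (p : ℕ) (c r : ℚ) : W.Point → Prop
  | .zero => True
  | .some x y _ => y ≠ 0 ∧ padicNorm p (x / (c * y)) ≤ r ∧ padicNorm p (1 / (c ^ 3 * y)) ≤ r ^ 3

/-- The coefficients of the curve, rescaled by `c`, are `p`-integral. -/
structure IntegralScaled (p : ℕ) (c : ℚ) (W : WeierstrassCurve.Affine ℚ) : Prop where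
  ne_zero : c ≠ 0
  a₂ : padicNorm p (c ^ 2 * W.a₂) ≤ 1
  a₄ : padicNorm p (c ^ 4 * W.a₄) ≤ 1
  a₆ : padicNorm p (c ^ 6 * W.a₆) ≤ 1

/-- P, Q and -(P + Q) are collinear, so their parameters add up to O(r³); the parameter is odd
because negation changes the sign of y only. -/
theorem NearInfinity.add (hW : IsShort W) {c r : ℚ} (hc : IntegralScaled p c W) (hr0 : 0 ≤ r)
    (hr : r < 1) {P Q : W.Point} (hP : NearInfinity p c r P) (hQ : NearInfinity p c r Q) :
    NearInfinity p c r (P + Q) ∧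
      padicNorm p (zCoord c (P + Q) - zCoord c P - zCoord c Q) ≤ r ^ 3 := by
  have hc0 := hc.ne_zero
  have hr3 : 0 ≤ r ^ 3 := pow_nonneg hr0 3
  have hzero : ((0 : W.Point)) = .zero := rfl
  cases P with
  | zero =>
    rw [← hzero, zero_add]
    exact ⟨hQ, by simpa [zCoord, hzero] using hr3⟩
  | some x₁ y₁ h₁ =>
  cases Q with
  | zero =>
    rw [← hzero, add_zero]
    exact ⟨hP, by simpa [zCoord, hzero] using hr3⟩
  | some x₂ y₂ h₂ =>
  by_cases hxy : x₁ = x₂ ∧ y₁ = -y₂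
  · obtain ⟨rfl, hy⟩ := hxy
    rw [hW.some_add_eq_zero h₁ h₂ hy]
    refine ⟨trivial, ?_⟩
    have : zCoord c (0 : W.Point) - zCoord c (.some x₁ y₁ h₁) - zCoord c (.some x₁ y₂ h₂) = 0 := by
      simp only [zCoord, hy]
      ring
    rw [this]; simpa using hr3
  · obtain ⟨L, M, x₃, y₃, h₃, hadd, hy₁, hy₂, hy₃, hl, -⟩ := hW.exists_line h₁ h₂ hxy
    rw [hadd]
    obtain ⟨hy₁0, hz₁, hw₁⟩ := hP
    obtain ⟨hy₂0, hz₂, hw₂⟩ := hQ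
    have f₁ : c * L * (c ^ 2 * x₁) + c ^ 3 * M = c ^ 3 * y₁ := by rw [hy₁]; ring
    have f₂ : c * L * (c ^ 2 * x₂) + c ^ 3 * M = c ^ 3 * y₂ := by rw [hy₂]; ring
    have f₃ : c * L * (c ^ 2 * x₃) + c ^ 3 * M = c ^ 3 * (-y₃) := by rw [hy₃]; ring
    have g : ∀ x y : ℚ, c ^ 2 * x / (c ^ 3 * y) = x / (c * y) := by
      intro x y
      rw [show c ^ 3 * y = c ^ 2 * (c * y) by ring, mul_div_mul_left _ _ (pow_ne_zero 2 hc0)]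
    have key := collinear_near_infinity (p := p) (L := c * L) (M := c ^ 3 * M) (X₁ := c ^ 2 * x₁)
      (X₂ := c ^ 2 * x₂) (X₃ := c ^ 2 * x₃) (r := r) (b₂ := c ^ 2 * W.a₂) (b₄ := c ^ 4 * W.a₄)
      (b₆ := c ^ 6 * W.a₆) (by rw [hl.a₂_eq]; ring) (by rw [hl.a₄_eq]; ring)
      (by rw [hl.a₆_eq]; ring) hc.a₂ hc.a₄ hc.a₆ hr
    rw [f₁, f₂, f₃, g, g, g] at key
    obtain ⟨k1, k2, k3, k4⟩ := key (mul_ne_zero (pow_ne_zero 3 hc0) hy₁0)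
      (mul_ne_zero (pow_ne_zero 3 hc0) hy₂0) hz₁ hw₁ hz₂ hw₂
    have m2 : x₃ / (c * -y₃) = -(x₃ / (c * y₃)) := by rw [mul_neg, div_neg]
    have m3 : 1 / (c ^ 3 * -y₃) = -(1 / (c ^ 3 * y₃)) := by rw [mul_neg, div_neg]
    rw [m2] at k2 k4
    rw [m3] at k3
    rw [padicNorm.neg] at k2 k3
    refine ⟨⟨?_, k2, k3⟩, ?_⟩
    · rintro rfl; simp at k1
    · have : zCoord c (.some x₃ y₃ h₃) - zCoord c (.some x₁ y₁ h₁) - zCoord c (.some x₂ y₂ h₂) =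
          -(x₁ / (c * y₁) + x₂ / (c * y₂) + -(x₃ / (c * y₃))) := by
        simp only [zCoord]; ring
      rw [this, padicNorm.neg]
      exact k4

theorem NearInfinity.nsmul (hW : IsShort W) {c r : ℚ} (hc : IntegralScaled p c W) (hr0 : 0 ≤ r)
    (hr : r < 1) {P : W.Point} (hP : NearInfinity p c r P) (n : ℕ) :
    NearInfinity p c r (n • P) ∧ padicNorm p (zCoord c (n • P) - n * zCoord c P) ≤ r ^ 3 := by
  induction n with
  | zero =>
    rw [zero_nsmul]
    refine ⟨trivial, ?_⟩
    have : zCoord c (0 : W.Point) = 0 := rfl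
    simpa [this] using pow_nonneg hr0 3
  | succ k ih =>
    rw [succ_nsmul]
    obtain ⟨h1, h2⟩ := NearInfinity.add hW hc hr0 hr ih.1 hP
    refine ⟨h1, ?_⟩
    have : zCoord c (k • P + P) - ((k + 1 : ℕ) : ℚ) * zCoord c P =
        (zCoord c (k • P + P) - zCoord c (k • P) - zCoord c P) +
          (zCoord c (k • P) - k * zCoord c P) := by
      push_cast; ring
    rw [this]
    exact padicNorm_add_le h2 ih.2

/-- A point near infinity is as near as its local parameter tells. -/
theorem NearInfinity.sharpen (hW : IsShort W) {c r : ℚ} (hc : IntegralScaled p c W)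
    (hr : r < 1) {P : W.Point} (hP : NearInfinity p c r P) :
    NearInfinity p c (padicNorm p (zCoord c P)) P := by
  have hc0 := hc.ne_zero
  cases P with
  | zero => trivial
  | some x y h =>
  obtain ⟨hy, hz, hw⟩ := hP
  refine ⟨hy, le_rfl, ?_⟩
  have hr0 : 0 ≤ r := (padicNorm.nonneg _).trans hz
  have r2 : r ^ 2 < 1 := pow_lt_one₀ hr0 hr two_ne_zero
  have r3 : r ^ 3 < 1 := pow_lt_one₀ hr0 hr three_ne_zero
  have e := (hW.equation_iff _ _).mp h.1
  have hn : padicNorm p (1 - (c ^ 2 * W.a₂ * (x / (c * y)) ^ 2 +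
      c ^ 4 * W.a₄ * (x / (c * y) * (1 / (c ^ 3 * y))) +
      c ^ 6 * W.a₆ * (1 / (c ^ 3 * y)) ^ 2)) = 1 := by
    rw [padicNorm_sub_eq_of_lt, padicNorm.one]
    rw [padicNorm.one]
    refine lt_of_le_of_lt (padicNorm_add_le (padicNorm_add_le
      ((padicNorm_mul_le hc.a₂ (padicNorm_pow_le hz 2)).trans ?_)
      ((padicNorm_mul_le hc.a₄ (padicNorm_mul_le hz hw)).trans ?_))
      ((padicNorm_mul_le hc.a₆ (padicNorm_pow_le hw 2)).trans ?_)) r2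
    · linarith
    · nlinarith [pow_nonneg hr0 3]
    · nlinarith [pow_nonneg hr0 3]
  -- The curve equation in the form w · unit = z³, so that |w| = |z|³ exactly.
  have key : 1 / (c ^ 3 * y) * (1 - (c ^ 2 * W.a₂ * (x / (c * y)) ^ 2 +
      c ^ 4 * W.a₄ * (x / (c * y) * (1 / (c ^ 3 * y))) +
      c ^ 6 * W.a₆ * (1 / (c ^ 3 * y)) ^ 2)) = (x / (c * y)) ^ 3 := by
    field_simp
    linear_combination e
  have := congrArg (padicNorm p) key
  rw [padicNorm.mul, hn, mul_one, padicNorm_pow] at this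
  exact this.le

/-- For a prime l, z([l]P) = l·z(P) + O(|z|³), while |l| ≥ 1/p ≥ |z| gives |l·z| ≥ |z|² > |z|³. The
cubic error term is what lets this work even for l = p = 2. General n follows multiplicatively. -/
theorem NearInfinity.nsmul_ne_zero (hW : IsShort W) {c r : ℚ} (hc : IntegralScaled p c W)
    (hr0 : 0 ≤ r) (hr : r < 1) {n : ℕ} (hn : n ≠ 0) {P : W.Point} (hP : NearInfinity p c r P)
    (hz : zCoord c P ≠ 0) : zCoord c (n • P) ≠ 0 := by
  induction n using Nat.recOnMul generalizing P with
  | zero => exact absurd rfl hn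
  | one => simpa using hz
  | prime l hl =>
    have hle : padicNorm p (zCoord c P) ≤ r := by
      cases P with
      | zero => exact absurd rfl hz
      | some x y h => exact hP.2.1
    have hlt := hle.trans_lt hr
    have h0 := padicNorm_pos (p := p) hz
    have hinv := padicNorm_le_inv_of_lt_one hlt
    have h2 := (NearInfinity.nsmul hW hc h0.le hlt (hP.sharpen hW hc hr) l).2
    intro h
    rw [h, zero_sub, padicNorm.neg, padicNorm.mul] at h2
    have h3 := (inv_le_padicNorm_natCast_prime (p := p) hl).trans' hinv
    have h4 : padicNorm p (zCoord c P) ^ 2 ≤ padicNorm p (l : ℚ) * padicNorm p (zCoord c P) := by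
      nlinarith
    have h5 : padicNorm p (zCoord c P) ^ 3 < padicNorm p (zCoord c P) ^ 2 := by
      nlinarith [pow_pos h0 2]
    linarith
  | mul a b iha ihb =>
    rw [mul_smul]
    exact iha (left_ne_zero_of_mul hn) (NearInfinity.nsmul hW hc hr0 hr hP b).1
      (ihb (right_ne_zero_of_mul hn) hP hz)

/-- A point whose (rescaled) `x`-coordinate is not `p`-integral has infinite order. -/
theorem nsmul_ne_zero_of_not_integral (hW : IsShort W) {c : ℚ} (hc : IntegralScaled p c W)
    {x y : ℚ} (h : W.Nonsingular x y) (hx : 1 < padicNorm p (c ^ 2 * x)) {n : ℕ} (hn : n ≠ 0) :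
    n • (WeierstrassCurve.Affine.Point.some x y h) ≠ 0 := by
  have hc0 := hc.ne_zero
  have e := (hW.equation_iff _ _).mp h.1
  set v := padicNorm p (c ^ 2 * x) with hv
  -- The term X³ dominates, so |Y|² = |X|³; hence |z|² = 1/|X| < 1 and |w| = |z|³.
  have hY : padicNorm p ((c ^ 3 * y) ^ 2) = v ^ 3 := by
    have : (c ^ 3 * y) ^ 2 = (c ^ 2 * x) ^ 3 + (c ^ 2 * W.a₂ * (c ^ 2 * x) ^ 2 +
        c ^ 4 * W.a₄ * (c ^ 2 * x) + c ^ 6 * W.a₆) := by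
      linear_combination c ^ 6 * e
    have hlt : padicNorm p (c ^ 2 * W.a₂ * (c ^ 2 * x) ^ 2 + c ^ 4 * W.a₄ * (c ^ 2 * x) +
        c ^ 6 * W.a₆) < v ^ 3 := by
      refine lt_of_le_of_lt (b := v ^ 2) (padicNorm_add_le (padicNorm_add_le
        ((padicNorm_mul_le hc.a₂ (padicNorm_pow_le le_rfl 2)).trans ?_)
        ((padicNorm_mul_le hc.a₄ le_rfl).trans ?_)) (hc.a₆.trans ?_)) ?_
      · rw [one_mul]
      · rw [← hv]; nlinarith
      · nlinarith
      · nlinarith [pow_pos (zero_lt_one.trans hx) 2]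
    rw [this, padicNorm_add_eq_of_lt] <;> rw [padicNorm_pow]
    exact hlt
  rw [padicNorm_pow] at hY
  set u := padicNorm p (c ^ 3 * y) with hu
  have hu0 : 0 ≤ u := padicNorm.nonneg _
  have hupos : 0 < u := by
    rcases hu0.lt_or_eq with h | h
    · exact h
    · rw [← h] at hY; nlinarith [pow_pos (zero_lt_one.trans hx) 3]
  have hy : y ≠ 0 := by
    rintro rfl
    simp [hu] at hupos
  have hx0 : x ≠ 0 := by
    rintro rfl
    simp [hv] at hx
    linarith
  have hvpos : 0 < v := zero_lt_one.trans hx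
  have hz : zCoord c (WeierstrassCurve.Affine.Point.some x y h) = c ^ 2 * x / (c ^ 3 * y) := by
    simp only [zCoord]
    field_simp
  have hzn : padicNorm p (c ^ 2 * x / (c ^ 3 * y)) = v / u := padicNorm.div _ _
  have hsq : (v / u) ^ 2 = v⁻¹ := by
    rw [div_pow, hY]; field_simp
  have hr0 : 0 ≤ v / u := by positivity
  have hr : v / u < 1 := by
    by_contra hge
    have h1 : 1 ≤ (v / u) ^ 2 := one_le_pow₀ (not_lt.mp hge)
    rw [hsq] at h1
    have := inv_lt_one_of_one_lt₀ hx
    linarith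
  have hP : NearInfinity p c (v / u) (WeierstrassCurve.Affine.Point.some x y h) := by
    refine ⟨hy, ?_, ?_⟩
    · rw [← hzn, ← hz]; exact le_rfl
    · rw [padicNorm.div, padicNorm.one, ← hu, div_pow]
      apply le_of_eq
      have : u ^ 3 = u * v ^ 3 := by rw [← hY]; ring
      rw [this]
      field_simp
  have hz0 : zCoord c (WeierstrassCurve.Affine.Point.some x y h) ≠ 0 := by
    rw [hz]
    exact div_ne_zero (mul_ne_zero (pow_ne_zero 2 hc0) hx0) (mul_ne_zero (pow_ne_zero 3 hc0) hy)
  intro h0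
  have := NearInfinity.nsmul_ne_zero hW hc hr0 hr hn hP hz0
  rw [h0] at this
  exact this rfl

end FormalGroup

/-! ### The point R has infinite order -/

theorem isShort_curveE (t : ℚ) : IsShort (curveE t) := ⟨rfl, rfl⟩

theorem isShort_curveE' (t x : ℚ) : IsShort (curveE' t x) := ⟨rfl, rfl⟩

theorem isShort_curveE'' (t x : ℚ) : IsShort (curveE'' t x) := ⟨rfl, rfl⟩

/-- This form shows y² + 27t²x², the norm of y + 3√-3 t x, to be a cube. -/
theorem equation_curveE {t x y : ℚ} (h : (curveE t).Nonsingular x y) :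
    y ^ 2 = (x + (t ^ 2 + 1) ^ 2) ^ 3 - 27 * t ^ 2 * x ^ 2 := by
  have := ((isShort_curveE t).equation_iff _ _).mp h.1
  simp only [curveE] at this
  linear_combination this

section Doubling

variable {W : WeierstrassCurve.Affine ℚ}

theorem IsShort.exists_double (hW : IsShort W) {x y : ℚ} (h : W.Nonsingular x y) (hy : y ≠ 0) :
    ∃ (L M x' y' : ℚ) (h' : W.Nonsingular x' y'),
      2 • (WeierstrassCurve.Affine.Point.some x y h) = .some x' y' h' ∧
      y = L * x + M ∧ -y' = L * x' + M ∧ LineMeets W L M x x x' ∧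
      L * (2 * y) = 3 * x ^ 2 + 2 * W.a₂ * x + W.a₄ := by
  obtain ⟨L, M, x', y', h', e, e1, -, e3, hl, e4⟩ := hW.exists_line h h (by
    rintro ⟨-, h0⟩
    exact hy (by linarith))
  exact ⟨L, M, x', y', h', by rw [two_nsmul, e], e1, e3, hl, by linear_combination e4⟩

end Doubling

theorem not_three_dvd_sq_add_sq {u v : ℤ} (h : IsCoprime u v) : ¬ (3 : ℤ) ∣ u ^ 2 + v ^ 2 := by
  intro hd
  have hsq : ∀ w : ℤ, (w % 3 = 0 ∧ w ^ 2 % 3 = 0) ∨ w ^ 2 % 3 = 1 := by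
    intro w
    have : w % 3 = 0 ∨ w % 3 = 1 ∨ w % 3 = 2 := by omega
    rcases this with h | h | h <;> simp [pow_two, Int.mul_emod, h]
  have hu := hsq u
  have hv := hsq v
  have h1 : (3 : ℤ) ∣ u := by omega
  have h2 : (3 : ℤ) ∣ v := by omega
  have := h.isUnit_of_dvd' h1 h2
  rw [Int.isUnit_iff] at this
  omega

/-- The point `R` has infinite order. -/
theorem nsmul_pointR_ne_zero (t : ℚ) {n : ℕ} (hn : n ≠ 0) : n • pointR t ≠ 0 := by
  have := Fact.mk Nat.prime_three
  set s : ℚ := t ^ 2 + 1 with hs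
  have hs0 : s ≠ 0 := by positivity
  have hW := isShort_curveE t
  obtain ⟨u, v, hv, huv, htuv⟩ : ∃ u v : ℤ, v ≠ 0 ∧ IsCoprime u v ∧ t = u / v :=
    ⟨t.num, t.den, mod_cast t.den_nz, t.isCoprime_num_den, by simp [Rat.num_div_den]⟩
  have hvq : (v : ℚ) ≠ 0 := mod_cast hv
  -- Scaling by v² clears the denominators of t = u/v. The scaled s is u² + v², a 3-adic unit
  -- because -1 is not a square modulo 3.
  set c : ℚ := (v : ℚ) ^ 2 with hc
  have hc0 : c ≠ 0 := pow_ne_zero 2 hvq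
  have hcs : c * s = ((u ^ 2 + v ^ 2 : ℤ) : ℚ) := by
    rw [hc, hs, htuv]; push_cast; field_simp
  have hct : c * t = ((u * v : ℤ) : ℚ) := by
    rw [hc, htuv]; push_cast; field_simp
  have nS : padicNorm 3 (c * s) = 1 := by
    rw [hcs, padicNorm.int_eq_one_iff]
    exact_mod_cast not_three_dvd_sq_add_sq huv
  have n3 : padicNorm 3 (3 : ℚ) = 3⁻¹ := by
    exact_mod_cast padicNorm.padicNorm_p_of_prime (p := 3)
  have n2 : padicNorm 3 (2 : ℚ) = 1 := by
    exact_mod_cast (padicNorm.nat_eq_one_iff (p := 3) 2).mpr (by norm_num)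
  have n4 : padicNorm 3 (4 : ℚ) = 1 := by
    exact_mod_cast (padicNorm.nat_eq_one_iff (p := 3) 4).mpr (by norm_num)
  have hint : IntegralScaled 3 c (curveE t) := by
    refine ⟨hc0, ?_, ?_, ?_⟩
    · have : c ^ 2 * (curveE t).a₂ = ((3 * ((u ^ 2 + v ^ 2) ^ 2 - 9 * (u * v) ^ 2) : ℤ) : ℚ) := by
        have : c ^ 2 * (curveE t).a₂ = 3 * ((c * s) ^ 2 - 9 * (c * t) ^ 2) := by
          simp only [curveE, hs]; ring
        rw [this, hcs, hct]; push_cast; ring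
      rw [this]; exact padicNorm.of_int _
    · have : c ^ 4 * (curveE t).a₄ = ((3 * (u ^ 2 + v ^ 2) ^ 4 : ℤ) : ℚ) := by
        have : c ^ 4 * (curveE t).a₄ = 3 * (c * s) ^ 4 := by simp only [curveE, hs]; ring
        rw [this, hcs]; push_cast; ring
      rw [this]; exact padicNorm.of_int _
    · have : c ^ 6 * (curveE t).a₆ = (((u ^ 2 + v ^ 2) ^ 6 : ℤ) : ℚ) := by
        have : c ^ 6 * (curveE t).a₆ = (c * s) ^ 6 := by simp only [curveE, hs]; ring
        rw [this, hcs]; push_cast; ring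
      rw [this]; exact padicNorm.of_int _
  have hy : s ^ 3 ≠ 0 := pow_ne_zero 3 hs0
  obtain ⟨L, M, x₂, y₂, h₂, e2, hM, hy₂, hl, hL⟩ := hW.exists_double (nonsingular_R t) hy
  have hM' : M = s ^ 3 := by rw [hs]; linarith
  have hL' : L = 3 * s / 2 := by
    have : L * (2 * s ^ 3) = 3 * s ^ 4 := by
      rw [hs]; simp only [curveE] at hL; linear_combination hL
    field_simp
    apply mul_right_cancel₀ hy
    linear_combination this
  have hx₂ : 4 * (c ^ 2 * x₂) = 3 * ((36 * (u * v) ^ 2 - (u ^ 2 + v ^ 2) ^ 2 : ℤ) : ℚ) := by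
    have : 4 * (c ^ 2 * x₂) = 3 * (36 * (c * t) ^ 2 - (c * s) ^ 2) := by
      have := hl.a₂_eq
      rw [hL'] at this
      simp only [curveE] at this
      have h1 : x₂ = (3 * s / 2) ^ 2 - 3 * (s ^ 2 - 9 * t ^ 2) := by
        rw [hs] at this ⊢; linear_combination this
      rw [h1]; ring
    rw [this, hcs, hct]; push_cast; ring
  have nx₂ : padicNorm 3 (c ^ 2 * x₂) = 3⁻¹ := by
    have := congrArg (padicNorm 3) hx₂
    rw [padicNorm.mul 4, padicNorm.mul 3, n4, n3, one_mul] at this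
    rw [this, (padicNorm.int_eq_one_iff _).mpr, mul_one]
    intro hd
    have h3 : (3 : ℤ) ∣ (u ^ 2 + v ^ 2) ^ 2 := by
      have : (u ^ 2 + v ^ 2) ^ 2 = 36 * (u * v) ^ 2 - (36 * (u * v) ^ 2 - (u ^ 2 + v ^ 2) ^ 2) := by
        ring
      rw [this]
      exact dvd_sub (Dvd.dvd.mul_right (by norm_num) _) (mod_cast hd)
    exact not_three_dvd_sq_add_sq huv (Int.prime_three.dvd_of_dvd_pow h3)
  have hx₂0 : x₂ ≠ 0 := by
    rintro rfl
    simp at nx₂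
  obtain ⟨L', M', x₃, y₃, h₃, e3, hM₁, hM₂, -, hl', -⟩ :=
    hW.exists_line (nonsingular_R t) h₂ (fun h => hx₂0 h.1.symm)
  have hcL : c * L' = -(3 * (c * s) / 2 + 2 * (c * s) ^ 3 / (c ^ 2 * x₂)) := by
    have h1 : L' * x₂ = -(L * x₂ + 2 * s ^ 3) := by
      rw [← hM'] ; rw [← hs] at hM₁; linear_combination hM₁ - hM₂ - hy₂ + hM'
    have h2 : L' = -(3 * s / 2 + 2 * s ^ 3 / x₂) := by
      apply mul_right_cancel₀ hx₂0
      rw [h1, hL']; field_simp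
    rw [h2]; field_simp
  -- Since x([2]R) has norm 1/3, the chord through R = (0, s³) and [2]R has slope of norm 3, and
  -- x([3]R) has norm 9: the third multiple enters the formal group.
  have ncL : padicNorm 3 (c * L') = 3 := by
    have hb : padicNorm 3 (2 * (c * s) ^ 3 / (c ^ 2 * x₂)) = 3 := by
      rw [padicNorm.div, padicNorm.mul, padicNorm_pow, nS, n2, nx₂]; norm_num
    rw [hcL, padicNorm.neg, add_comm, padicNorm_add_eq_of_lt, hb]
    rw [hb, padicNorm.div, padicNorm.mul, n3, nS, n2]; norm_num
  have nx₃ : 1 < padicNorm 3 (c ^ 2 * x₃) := by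
    have : c ^ 2 * x₃ = (c * L') ^ 2 - (c ^ 2 * (curveE t).a₂ + c ^ 2 * x₂) := by
      rw [hl'.a₂_eq]; ring
    have n9 : padicNorm 3 ((c * L') ^ 2) = 9 := by rw [padicNorm_pow, ncL]; norm_num
    rw [this, padicNorm_sub_eq_of_lt, n9]
    · norm_num
    · rw [n9]
      exact lt_of_le_of_lt (padicNorm_add_le hint.a₂ (by rw [nx₂]; norm_num)) (by norm_num)
  have h3R : 3 • pointR t = .some x₃ y₃ h₃ := by
    rw [← e3, ← e2, pointR]
    abel
  intro h0
  apply nsmul_ne_zero_of_not_integral hW hint h₃ nx₃ hn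
  rw [← h3R, smul_comm, h0, nsmul_zero]

/-! ### Multiples of R and cubes in ℚ(√-3) -/

/-- `y + 3√-3 t x = (g + h√-3)³` for a point `(x, y)` of `E`: the point lies in the image of the
`3`-isogeny onto `E`. -/
def IsCubic (t x y g h : ℚ) : Prop :=
  t * x = h * (g ^ 2 - h ^ 2) ∧ y = g * (g ^ 2 - 9 * h ^ 2) ∧
    x + (t ^ 2 + 1) ^ 2 = g ^ 2 + 3 * h ^ 2

/-- If the line through (x₁, y₁) and R has slope L and third point (x₃, -y₃), then (y₁ + 3√-3 t
x₁)(-y₃ + 3√-3 t x₃) = s³((s - L) - 3t√-3)³. So the second factor is a cube if the first is. -/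
theorem exists_isCubic_add {t x₁ y₁ : ℚ} (ht : t ≠ 0) (h₁ : (curveE t).Nonsingular x₁ y₁)
    {g h : ℚ} (hc : IsCubic t x₁ y₁ g h) :
    WeierstrassCurve.Affine.Point.some x₁ y₁ h₁ + pointR t = 0 ∨
      ∃ x₃ y₃ h₃ g' h', WeierstrassCurve.Affine.Point.some x₁ y₁ h₁ + pointR t = .some x₃ y₃ h₃ ∧
        IsCubic t x₃ y₃ g' h' := by
  have hW := isShort_curveE t
  by_cases hxy : x₁ = 0 ∧ y₁ = -(t ^ 2 + 1) ^ 3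
  · left
    obtain ⟨rfl, hy⟩ := hxy
    exact hW.some_add_eq_zero h₁ (nonsingular_R t) hy
  right
  obtain ⟨L, M, x₃, y₃, h₃, e, hy₁, hM, hy₃, hl, -⟩ := hW.exists_line h₁ (nonsingular_R t) hxy
  obtain ⟨c1, c2, c3⟩ := hc
  have hM' : M = (t ^ 2 + 1) ^ 3 := by linarith
  set s := t ^ 2 + 1 with hs
  have hs0 : s ≠ 0 := by positivity
  have a2 := hl.a₂_eq
  have a4 := hl.a₄_eq
  simp only [curveE, ← hs] at a2 a4
  subst hM'
  have e₃ := equation_curveE h₃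
  rw [← hs] at e₃
  have a2' : 3 * (s ^ 2 - 9 * t ^ 2) = L ^ 2 - x₁ - x₃ := by rw [hs]; linear_combination a2
  have a4' : 3 * s ^ 4 = x₁ * x₃ + 2 * L * s ^ 3 := by linear_combination a4
  have hpos : g ^ 2 + 3 * h ^ 2 ≠ 0 := by
    intro h0
    have hh : h = 0 := by nlinarith [sq_nonneg g, sq_nonneg h]
    have hx0 : x₁ = 0 := by simpa [hh, ht] using c1
    rw [hx0, h0] at c3
    exact hs0 (by simpa using c3)
  clear_value s
  clear a2 a4 hl hM
  have I : y₁ * (-y₃) - 27 * t ^ 2 * x₁ * x₃ = s ^ 3 * ((s - L) ^ 3 - 81 * (s - L) * t ^ 2) := by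
    rw [hy₁, hy₃]
    linear_combination -(L ^ 2 - 27 * t ^ 2) * a4' + L * s ^ 3 * a2'
  have II : 3 * t * (y₁ * x₃ + x₁ * (-y₃)) = s ^ 3 * (81 * t ^ 3 - 9 * (s - L) ^ 2 * t) := by
    rw [hy₁, hy₃]
    linear_combination 3 * t * (-2 * L * a4' + s ^ 3 * a2')
  set N := g ^ 2 + 3 * h ^ 2 with hN
  have hN3 : N ^ 3 = y₁ ^ 2 + 27 * (t * x₁) ^ 2 := by rw [c1, c2, hN]; ring
  -- A + B√-3 = ((s - L) - 3t√-3)(g - h√-3), the numerator of the quotient by g + h√-3, whose norm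
  -- is N.
  obtain ⟨A, hA⟩ : ∃ A, A = (s - L) * g - 9 * t * h := ⟨_, rfl⟩
  obtain ⟨B, hB⟩ : ∃ B, B = -((s - L) * h + 3 * t * g) := ⟨_, rfl⟩
  have nU : N ^ 3 * (-y₃) = s ^ 3 * (A * (A ^ 2 - 9 * B ^ 2)) := by
    have : N ^ 3 * (-y₃) = y₁ * (s ^ 3 * ((s - L) ^ 3 - 81 * (s - L) * t ^ 2)) +
        3 * (t * x₁) * (3 * (s ^ 3 * (81 * t ^ 3 - 9 * (s - L) ^ 2 * t))) := by
      rw [hN3]; linear_combination y₁ * I + 9 * t * x₁ * II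
    rw [this, c1, c2, hA, hB]; ring
  have nV : N ^ 3 * (t * x₃) = s ^ 3 * (B * (A ^ 2 - B ^ 2)) := by
    have : N ^ 3 * (t * x₃) = y₁ * (s ^ 3 * (27 * t ^ 3 - 3 * (s - L) ^ 2 * t)) -
        t * x₁ * (s ^ 3 * ((s - L) ^ 3 - 81 * (s - L) * t ^ 2)) := by
      rw [hN3]; linear_combination y₁ * II / 3 - t * x₁ * I
    rw [this, c1, c2, hA, hB]; ring
  have r1 : t * x₃ = s * B / N * ((-(s * A / N)) ^ 2 - (s * B / N) ^ 2) := by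
    field_simp
    linear_combination nV
  have r2 : y₃ = -(s * A / N) * ((-(s * A / N)) ^ 2 - 9 * (s * B / N) ^ 2) := by
    field_simp
    linear_combination -nU
  refine ⟨x₃, y₃, h₃, -(s * A / N), s * B / N, e, r1, r2, ?_⟩
  rw [← hs]
  -- The norms of both sides have equal cubes, and rational cube roots are unique.
  have hodd : Odd 3 := by decide
  apply hodd.strictMono_pow.injective
  change (x₃ + s ^ 2) ^ 3 = ((-(s * A / N)) ^ 2 + 3 * (s * B / N) ^ 2) ^ 3
  have : (x₃ + s ^ 2) ^ 3 = y₃ ^ 2 + 27 * (t * x₃) ^ 2 := by linear_combination -e₃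
  rw [this, r1, r2]
  ring

/-- Every nonzero multiple of `R` lies in the image of the `3`-isogeny onto `E`. -/
theorem nsmul_pointR_eq_zero_or_isCubic {t : ℚ} (ht : t ≠ 0) (n : ℕ) :
    n • pointR t = 0 ∨ ∃ x y h g k, n • pointR t = .some x y h ∧ IsCubic t x y g k := by
  induction n with
  | zero => left; rw [zero_nsmul]
  | succ n ih =>
    rw [succ_nsmul]
    rcases ih with h | ⟨x, y, h, g, k, e, hc⟩
    · right
      refine ⟨_, _, nonsingular_R t, t ^ 2 + 1, 0, by rw [h, zero_add, pointR], ?_⟩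
      refine ⟨by ring, by ring, by ring⟩
    · rw [e]
      exact exists_isCubic_add ht h hc

/-- The rational parametrisation of the nontrivial multiples of `R`. -/
theorem exists_nsmul_pointR {t : ℚ} (ht : t ≠ 0) {m : ℕ} (hm : 1 < m) :
    ∃ x y h g k, m • pointR t = .some x y h ∧ x ≠ 0 ∧ y ≠ 0 ∧ IsCubic t x y g k := by
  have hW := isShort_curveE t
  rcases nsmul_pointR_eq_zero_or_isCubic ht m with h0 | ⟨x, y, h, g, k, e, hc⟩
  · exact absurd h0 (nsmul_pointR_ne_zero t (by omega))
  refine ⟨x, y, h, g, k, e, ?_, ?_, hc⟩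
  · rintro rfl
    have e₁ := (hW.equation_iff _ _).mp h.1
    have : (y - (t ^ 2 + 1) ^ 3) * (y + (t ^ 2 + 1) ^ 3) = 0 := by
      simp only [curveE] at e₁
      linear_combination e₁
    rcases mul_eq_zero.mp this with h1 | h1
    · have hy : y = (t ^ 2 + 1) ^ 3 := by linarith
      subst hy
      apply nsmul_pointR_ne_zero t (n := m - 1) (by omega)
      have : (m - 1) • pointR t + pointR t = 0 + pointR t := by
        rw [← succ_nsmul, Nat.sub_add_cancel hm.le, e, zero_add, pointR]
      exact add_right_cancel this
    · apply nsmul_pointR_ne_zero t (n := m + 1) (by omega)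
      rw [succ_nsmul, e]
      exact hW.some_add_eq_zero h (nonsingular_R t) (by linarith)
  · rintro rfl
    apply nsmul_pointR_ne_zero t (n := m + m) (by omega)
    rw [add_nsmul, e]
    exact hW.some_add_eq_zero h h (by norm_num)

/-! ### Reduction of E at odd primes dividing t² - 1 -/

section Reduction

variable {p : ℕ} [Fact p.Prime] {a b : ℚ}

theorem padicNorm_add_lt {r : ℚ} (ha : padicNorm p a < r) (hb : padicNorm p b < r) :
    padicNorm p (a + b) < r :=
  padicNorm.nonarchimedean.trans_lt (max_lt ha hb)

theorem padicNorm_sub_lt {r : ℚ} (ha : padicNorm p a < r) (hb : padicNorm p b < r) :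
    padicNorm p (a - b) < r :=
  padicNorm.sub.trans_lt (max_lt ha hb)

theorem padicNorm_mul_lt_one (ha : padicNorm p a ≤ 1) (hb : padicNorm p b < 1) :
    padicNorm p (a * b) < 1 := by
  rw [padicNorm.mul]
  nlinarith [padicNorm.nonneg (p := p) a, padicNorm.nonneg (p := p) b]

/-- Modulo an odd prime dividing `t² - 1` the curve `E` has the singular point `(8, 0)`. No
multiple of `R` reduces to it. -/
theorem not_node_of_nsmul_pointR (hp : p ≠ 2) {t : ℚ} (ht : padicNorm p (t ^ 2 - 1) < 1) (n : ℕ) :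
    ∀ x y h, n • pointR t = .some x y h → ¬ padicNorm p (x - 8) < 1 := by
  have n2 := padicNorm_two_of_odd_prime hp
  have n8 : padicNorm p (8 : ℚ) = 1 := by
    rw [show (8 : ℚ) = 2 ^ 3 by norm_num, padicNorm_pow, n2, one_pow]
  have hW := isShort_curveE t
  induction n with
  | zero =>
    intro x y h e
    rw [zero_nsmul] at e
    exact absurd e.symm (WeierstrassCurve.Affine.Point.some_ne_zero h)
  | succ n ih =>
    intro x y h e hx
    have hx0 : x ≠ 0 := by
      rintro rfl
      rw [zero_sub, padicNorm.neg, n8] at hx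
      exact lt_irrefl _ hx
    have nx : padicNorm p x = 1 := by
      have : x = 8 + (x - 8) := by ring
      rw [this, padicNorm_add_eq_of_lt, n8]
      rwa [n8]
    -- Descent: if [n+1]R reduces to (8, 0), the chord to -R ≡ (0, -8) has slope ≡ 1 and its third
    -- intersection again has x ≡ 8, because a line meets the curve doubly at a singular point. So
    -- [n]R reduces there too, and eventually O would.
    obtain ⟨h', hneg⟩ := hW.neg_some (nonsingular_R t)
    have hsub : n • pointR t = WeierstrassCurve.Affine.Point.some x y h + .some _ _ h' := by
      rw [← e, ← hneg, succ_nsmul, pointR]; abel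
    obtain ⟨L, M, x₃, y₃, h₃, e₃, hy, hM, -, hl, -⟩ := hW.exists_line h h' (fun hh => hx0 hh.1)
    rw [← hsub] at e₃
    refine ih _ _ _ e₃ ?_
    set τ := t ^ 2 - 1 with hτ
    set δ := x - 8 with hδ
    have nt := ht.le
    have nd := hx.le
    have c0 : ∀ k : ℕ, padicNorm p (k : ℚ) ≤ 1 := fun k => padicNorm.of_nat k
    have hy1 : padicNorm p y < 1 := by
      have e₁ := equation_curveE h
      have : y ^ 2 = (δ + τ * (τ + (4 : ℕ))) * ((δ + τ * (τ + (4 : ℕ)) + (36 : ℕ)) *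
            (δ + τ * (τ + (4 : ℕ))) + (432 : ℕ)) -
          (27 : ℕ) * (τ * (δ + (8 : ℕ)) ^ 2 + δ * (δ + (16 : ℕ))) := by
        push_cast
        rw [e₁, hτ, hδ]; ring
      have n1 : padicNorm p (τ * (τ + (4 : ℕ))) < 1 := by
        rw [mul_comm]
        exact padicNorm_mul_lt_one (padicNorm_add_le nt (c0 _)) ht
      have n2 := padicNorm_add_lt hx n1
      have n3 : padicNorm p (y ^ 2) < 1 := by
        rw [this]
        refine padicNorm_sub_lt ?_ (padicNorm_mul_lt_one (c0 _) (padicNorm_add_lt ?_ ?_))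
        · rw [mul_comm]
          refine padicNorm_mul_lt_one (padicNorm_add_le ?_ (c0 _)) n2
          exact (padicNorm_mul_lt_one (padicNorm_add_le n2.le (c0 _)) n2).le
        · rw [mul_comm]
          exact padicNorm_mul_lt_one
            ((padicNorm_pow_le (padicNorm_add_le nd (c0 _)) 2).trans_eq (one_pow 2)) ht
        · rw [mul_comm]
          exact padicNorm_mul_lt_one (padicNorm_add_le nd (c0 _)) hx
      rw [padicNorm_pow] at n3
      by_contra hge
      exact absurd n3 (not_lt.mpr (one_le_pow₀ (not_lt.mp hge)))
    have hL : padicNorm p (L - 1) < 1 := by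
      have hLx : (L - 1) * x = y + (τ * (τ ^ 2 + (6 : ℕ) * τ + (12 : ℕ)) - δ) := by
        have : -(t ^ 2 + 1) ^ 3 = M := by rw [hM]; ring
        push_cast
        rw [hδ, hτ]
        linear_combination this - hy
      have : padicNorm p ((L - 1) * x) < 1 := by
        rw [hLx]
        refine padicNorm_add_lt hy1 (padicNorm_sub_lt ?_ hx)
        rw [mul_comm]
        refine padicNorm_mul_lt_one (padicNorm_add_le (padicNorm_add_le ?_
          ((padicNorm_mul_le (c0 _) nt).trans_eq (one_mul 1))) (c0 _)) ht
        exact (padicNorm_pow_le nt 2).trans_eq (one_pow 2)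
      rwa [padicNorm.mul, nx, mul_one] at this
    have key : x₃ - 8 = (L - 1 + (2 : ℕ)) * (L - 1) - (3 : ℕ) * ((τ - (5 : ℕ)) * τ) - δ := by
      have a2 := hl.a₂_eq
      simp only [curveE] at a2
      push_cast
      rw [hτ, hδ]
      linear_combination a2
    rw [key]
    exact padicNorm_sub_lt (padicNorm_sub_lt
      (padicNorm_mul_lt_one (padicNorm_add_le hL.le (c0 _)) hL)
      (padicNorm_mul_lt_one (c0 _) (padicNorm_mul_lt_one (padicNorm_sub_le nt (c0 _)) ht))) hx

end Reduction

/-! ### Curves with three rational 2-torsion points -/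

section TwoTorsion

variable {W : WeierstrassCurve.Affine ℚ}

/-- The curve is `y² = (x - e₁)(x - e₂)(x - e₃)`. -/
structure HasRoots (W : WeierstrassCurve.Affine ℚ) (e₁ e₂ e₃ : ℚ) : Prop where
  short : IsShort W
  a₂_eq : W.a₂ = -(e₁ + e₂ + e₃)
  a₄_eq : W.a₄ = e₁ * e₂ + e₁ * e₃ + e₂ * e₃
  a₆_eq : W.a₆ = -(e₁ * e₂ * e₃)

theorem HasRoots.equation_iff {e₁ e₂ e₃ : ℚ} (h : HasRoots W e₁ e₂ e₃) (x y : ℚ) :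
    W.Equation x y ↔ y ^ 2 = (x - e₁) * (x - e₂) * (x - e₃) := by
  rw [h.short.equation_iff, h.a₂_eq, h.a₄_eq, h.a₆_eq]
  constructor <;> intro hh <;> rw [hh] <;> ring

theorem HasRoots.rotate {e₁ e₂ e₃ : ℚ} (h : HasRoots W e₁ e₂ e₃) : HasRoots W e₂ e₃ e₁ :=
  ⟨h.short, by rw [h.a₂_eq]; ring, by rw [h.a₄_eq]; ring, by rw [h.a₆_eq]; ring⟩

theorem HasRoots.isElliptic {e₁ e₂ e₃ : ℚ} (h : HasRoots W e₁ e₂ e₃) (h₁₂ : e₁ ≠ e₂)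
    (h₁₃ : e₁ ≠ e₃) (h₂₃ : e₂ ≠ e₃) : W.IsElliptic := by
  refine ⟨isUnit_iff_ne_zero.mpr ?_⟩
  have : W.Δ = 16 * ((e₁ - e₂) * (e₁ - e₃) * (e₂ - e₃)) ^ 2 := by
    rw [WeierstrassCurve.Δ, WeierstrassCurve.b₂, WeierstrassCurve.b₄, WeierstrassCurve.b₆,
      WeierstrassCurve.b₈, h.short.1, h.short.2, h.a₂_eq, h.a₄_eq, h.a₆_eq]
    ring
  rw [this]
  exact mul_ne_zero (by norm_num) (pow_ne_zero 2 (mul_ne_zero (mul_ne_zero (sub_ne_zero.mpr h₁₂)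
    (sub_ne_zero.mpr h₁₃)) (sub_ne_zero.mpr h₂₃)))

theorem HasRoots.nonsingular {e₁ e₂ e₃ : ℚ} (h : HasRoots W e₁ e₂ e₃) (h₁₂ : e₁ ≠ e₂)
    (h₁₃ : e₁ ≠ e₃) (h₂₃ : e₂ ≠ e₃) {x y : ℚ} (hxy : y ^ 2 = (x - e₁) * (x - e₂) * (x - e₃)) :
    W.Nonsingular x y := by
  have := h.isElliptic h₁₂ h₁₃ h₂₃
  exact (WeierstrassCurve.Affine.equation_iff_nonsingular).mp ((h.equation_iff x y).mpr hxy)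

theorem IsShort.two_nsmul_eq_zero_iff (hW : IsShort W) {x y : ℚ} (h : W.Nonsingular x y) :
    2 • (WeierstrassCurve.Affine.Point.some x y h) = 0 ↔ y = 0 := by
  constructor
  · intro h0
    by_contra hy
    obtain ⟨_, _, _, _, h', e, -⟩ := hW.exists_double h hy
    rw [e] at h0
    exact WeierstrassCurve.Affine.Point.some_ne_zero h' h0
  · rintro rfl
    rw [two_nsmul]
    exact hW.some_add_eq_zero h h (by norm_num)

theorem HasRoots.two_nsmul_eq_zero {e₁ e₂ e₃ : ℚ} (h : HasRoots W e₁ e₂ e₃) {x y : ℚ}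
    (hxy : W.Nonsingular x y) (h0 : y = 0) : x = e₁ ∨ x = e₂ ∨ x = e₃ := by
  have := (h.equation_iff x y).mp hxy.1
  rw [h0, zero_pow two_ne_zero, eq_comm, mul_eq_zero, mul_eq_zero, sub_eq_zero, sub_eq_zero,
    sub_eq_zero] at this
  tauto

theorem HasRoots.hasFullRationalTwoTorsion {e₁ e₂ e₃ : ℚ} (h : HasRoots W e₁ e₂ e₃)
    (h₁₂ : e₁ ≠ e₂) (h₁₃ : e₁ ≠ e₃) (h₂₃ : e₂ ≠ e₃) : HasFullRationalTwoTorsion W := by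
  have n₁ : W.Nonsingular e₁ 0 := h.nonsingular h₁₂ h₁₃ h₂₃ (by ring)
  have n₂ : W.Nonsingular e₂ 0 := h.nonsingular h₁₂ h₁₃ h₂₃ (by ring)
  have n₃ : W.Nonsingular e₃ 0 := h.nonsingular h₁₂ h₁₃ h₂₃ (by ring)
  have hmem : ∀ P : W.Point, P ∈ AddSubgroup.torsionBy W.Point 2 ↔ 2 • P = 0 := by
    intro P
    change (2 : ℤ) • P = 0 ↔ _
    rw [two_zsmul, two_nsmul]
  have hset : (AddSubgroup.torsionBy W.Point 2 : Set W.Point) =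
      {0, .some e₁ 0 n₁, .some e₂ 0 n₂, .some e₃ 0 n₃} := by
    ext P
    rw [SetLike.mem_coe, hmem]
    cases P with
    | zero => simp [← WeierstrassCurve.Affine.Point.zero_def]
    | some x y hxy =>
      rw [h.short.two_nsmul_eq_zero_iff]
      simp only [Set.mem_insert_iff, Set.mem_singleton_iff,
        WeierstrassCurve.Affine.Point.some_ne_zero, false_or,
        WeierstrassCurve.Affine.Point.some.injEq]
      constructor
      · intro h0
        have := h.two_nsmul_eq_zero hxy h0
        tauto
      · tauto
  have hcard : Nat.card (AddSubgroup.torsionBy W.Point 2) = 4 := by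
    have : Nat.card (AddSubgroup.torsionBy W.Point 2) =
        (AddSubgroup.torsionBy W.Point 2 : Set W.Point).ncard := Nat.card_coe_set_eq _
    rw [this, hset, Set.ncard_insert_of_notMem, Set.ncard_insert_of_notMem, Set.ncard_pair]
    · simpa using h₂₃
    · simp [h₁₂, h₁₃]
    · simp [eq_comm (a := (0 : W.Point))]
  have hnt : Nontrivial (AddSubgroup.torsionBy W.Point 2) := by
    have : Finite (AddSubgroup.torsionBy W.Point 2) :=
      Nat.finite_of_card_ne_zero (by rw [hcard]; norm_num)
    exact Finite.one_lt_card_iff_nontrivial.mp (by rw [hcard]; norm_num)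
  have hexp : AddMonoid.exponent (AddSubgroup.torsionBy W.Point 2) = 2 := by
    rw [AddMonoid.exponent_eq_prime_iff Nat.prime_two]
    intro g hg
    refine addOrderOf_eq_prime ?_ hg
    have := (hmem g.1).mp g.2
    ext1
    simpa using this
  have : IsAddKleinFour (AddSubgroup.torsionBy W.Point 2) := ⟨hcard, hexp⟩
  exact IsAddKleinFour.nonempty_addEquiv

end TwoTorsion

/-! ### The triple attached to a multiple of R -/

/-- A rational triple `{a, b, c}` with `ab + 1 = A²`, `ac + 1 = B²`, `bc + 1 = C²` for which the
point with `x`-coordinate `1` on `Y² = (X + ab)(X + ac)(X + bc)` has order three. -/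
structure TripleData (t x a b c A B C : ℚ) : Prop where
  t_ne : t ≠ 0
  ab : a * b + 1 = A ^ 2
  ac : a * c + 1 = B ^ 2
  bc : b * c + 1 = C ^ 2
  abc : a * b * c = sigma₃ t
  abc_ne : a * b * c ≠ 0
  flex : A * B + A * C + B * C = 0
  sum_add_prod : A + B + C + A * B * C = (t ^ 2 + 1) / (2 * t)
  A_ne : A ≠ 0
  B_ne : B ≠ 0
  C_ne : C ≠ 0
  AB : A ^ 2 ≠ B ^ 2
  AC : A ^ 2 ≠ C ^ 2
  BC : B ^ 2 ≠ C ^ 2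
  sigma₁_eq : sigma₁ t x = a + b + c
  sigma₂_eq : sigma₂ t x = a * b + a * c + b * c

theorem sigma₃_sq (t : ℚ) (ht : t ≠ 0) : sigma₃ t ^ 2 = ((t ^ 2 + 1) / (2 * t)) ^ 2 - 1 := by
  rw [sigma₃]
  field_simp
  ring

/-- With A = s/(2h), B = -s/(g+h), C = s/(g-h) the inverses sum to zero, so e₂ = 0. The denominators
are nonzero because tx = h(g-h)(g+h) ≠ 0, and y = g(g-3h)(g+3h) ≠ 0 keeps A², B², C² distinct. With
e₂ = 0 and e₁ + e₃ = s/(2t), the product of A²-1, B²-1, C²-1 is σ₃² ≠ 0, which forces c = σ₃/(A²-1)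
and its analogues. -/
theorem exists_tripleData {t x y g h : ℚ} (ht : t ≠ 0) (ht₁ : t ≠ 1) (ht₂ : t ≠ -1) (hx : x ≠ 0)
    (hy : y ≠ 0) (hc : IsCubic t x y g h) :
    ∃ a b c A B C : ℚ, TripleData t x a b c A B C ∧
      A + B + C = (t ^ 2 + 1) * (x + (t ^ 2 + 1) ^ 2) / (2 * t * x) ∧
      A * B * C = -(t ^ 2 + 1) ^ 3 / (2 * t * x) := by
  obtain ⟨c1, c2, c3⟩ := hc
  set s := t ^ 2 + 1 with hs
  have hs0 : s ≠ 0 := by positivity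
  have hd : t ^ 2 - 1 ≠ 0 := by
    intro h0
    have : (t - 1) * (t + 1) = 0 := by linear_combination h0
    rcases mul_eq_zero.mp this with h1 | h1
    · exact ht₁ (by linarith)
    · exact ht₂ (by linarith)
  have hprod : h * ((g - h) * (g + h)) ≠ 0 := by
    have : h * ((g - h) * (g + h)) = t * x := by rw [c1]; ring
    rw [this]; exact mul_ne_zero ht hx
  have h0 : h ≠ 0 := left_ne_zero_of_mul hprod
  have hm : g - h ≠ 0 := left_ne_zero_of_mul (right_ne_zero_of_mul hprod)
  have hp : g + h ≠ 0 := right_ne_zero_of_mul (right_ne_zero_of_mul hprod)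
  have hyy : g * ((g - 3 * h) * (g + 3 * h)) ≠ 0 := by
    have : g * ((g - 3 * h) * (g + 3 * h)) = y := by rw [c2]; ring
    rw [this]; exact hy
  have hg : g ≠ 0 := left_ne_zero_of_mul hyy
  have hm3 : g - 3 * h ≠ 0 := left_ne_zero_of_mul (right_ne_zero_of_mul hyy)
  have hp3 : g + 3 * h ≠ 0 := right_ne_zero_of_mul (right_ne_zero_of_mul hyy)
  obtain ⟨A, hA⟩ : ∃ A, A = s / (2 * h) := ⟨_, rfl⟩
  obtain ⟨B, hB⟩ : ∃ B, B = -(s / (g + h)) := ⟨_, rfl⟩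
  obtain ⟨C, hC⟩ : ∃ C, C = s / (g - h) := ⟨_, rfl⟩
  have hA0 : A ≠ 0 := by rw [hA]; positivity
  have hB0 : B ≠ 0 := by rw [hB]; exact neg_ne_zero.mpr (div_ne_zero hs0 hp)
  have hC0 : C ≠ 0 := by rw [hC]; exact div_ne_zero hs0 hm
  have hflex : A * B + A * C + B * C = 0 := by
    rw [hA, hB, hC]; field_simp; ring
  have htx : t * x = h * ((g - h) * (g + h)) := by rw [c1]; ring
  have he₁ : A + B + C = s * (x + s ^ 2) / (2 * t * x) := by
    rw [mul_assoc 2 t x, htx, c3, hA, hB, hC]; field_simp; ring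
  have he₃ : A * B * C = -s ^ 3 / (2 * t * x) := by
    rw [mul_assoc 2 t x, htx, hA, hB, hC]; field_simp
  have hq : A + B + C + A * B * C = s / (2 * t) := by
    rw [he₁, he₃]; field_simp; ring
  have hAB : A ^ 2 ≠ B ^ 2 := by
    intro e
    have : s ^ 2 * ((g + 3 * h) * (g - h)) = 0 := by
      rw [hA, hB] at e; field_simp at e; linear_combination s ^ 2 * e
    exact mul_ne_zero (pow_ne_zero 2 hs0) (mul_ne_zero hp3 hm) this
  have hAC : A ^ 2 ≠ C ^ 2 := by
    intro e
    have : s ^ 2 * ((g + h) * (g - 3 * h)) = 0 := by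
      rw [hA, hC] at e; field_simp at e; linear_combination s ^ 2 * e
    exact mul_ne_zero (pow_ne_zero 2 hs0) (mul_ne_zero hp hm3) this
  have hBC : B ^ 2 ≠ C ^ 2 := by
    intro e
    have : s ^ 2 * (4 * (g * h)) = 0 := by
      rw [hB, hC] at e; field_simp at e; linear_combination -s ^ 2 * e
    exact mul_ne_zero (pow_ne_zero 2 hs0) (mul_ne_zero (by norm_num) (mul_ne_zero hg h0)) this
  have hσ0 : sigma₃ t ≠ 0 := div_ne_zero hd (by positivity)
  have hσsq := sigma₃_sq t ht
  rw [← hs, ← hq] at hσsq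
  have hσ : sigma₃ t ^ 2 = (A ^ 2 - 1) * (B ^ 2 - 1) * (C ^ 2 - 1) := by
    rw [hσsq]
    linear_combination (A * B + A * C + B * C + 2) * hflex
  have hprod' : (A ^ 2 - 1) * (B ^ 2 - 1) * (C ^ 2 - 1) ≠ 0 := hσ ▸ pow_ne_zero 2 hσ0
  have hA1 : A ^ 2 - 1 ≠ 0 := left_ne_zero_of_mul (left_ne_zero_of_mul hprod')
  have hB1 : B ^ 2 - 1 ≠ 0 := right_ne_zero_of_mul (left_ne_zero_of_mul hprod')
  have hC1 : C ^ 2 - 1 ≠ 0 := right_ne_zero_of_mul hprod'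
  obtain ⟨a, ha⟩ : ∃ a, a = sigma₃ t / (C ^ 2 - 1) := ⟨_, rfl⟩
  obtain ⟨b, hb⟩ : ∃ b, b = sigma₃ t / (B ^ 2 - 1) := ⟨_, rfl⟩
  obtain ⟨c, hc⟩ : ∃ c, c = sigma₃ t / (A ^ 2 - 1) := ⟨_, rfl⟩
  have hab : a * b = A ^ 2 - 1 := by
    rw [ha, hb, div_mul_div_comm, ← sq, hσ]; field_simp
  have hac : a * c = B ^ 2 - 1 := by
    rw [ha, hc, div_mul_div_comm, ← sq, hσ]; field_simp
  have hbc : b * c = C ^ 2 - 1 := by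
    rw [hb, hc, div_mul_div_comm, ← sq, hσ]; field_simp
  have habc : a * b * c = sigma₃ t := by
    rw [hab, hc]; field_simp
  have hθ : sigma₁ t x * sigma₃ t = 3 - 2 * (A + B + C + A * B * C) * (A + B + C) := by
    rw [hq, he₁, sigma₁, sigma₃, ← hs]
    field_simp
    rw [hs]
    ring
  have hσ₁ : sigma₁ t x = a + b + c := by
    apply mul_right_cancel₀ hσ0
    have : (a + b + c) * sigma₃ t = a * b * (a * c) + a * b * (b * c) + a * c * (b * c) := by
      rw [← habc]; ring
    rw [this, hθ, hab, hac, hbc]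
    linear_combination (-(A * B + A * C + B * C) - 4) * hflex
  have hq0 : A + B + C + A * B * C ≠ 0 := by rw [hq]; exact div_ne_zero hs0 (by positivity)
  have hσ₂ : sigma₂ t x = a * b + a * c + b * c := by
    have e1 : sigma₁ t x ^ 2 * sigma₃ t ^ 2 = (sigma₁ t x * sigma₃ t) ^ 2 := by ring
    have e2 : 6 * sigma₁ t x * sigma₃ t = 6 * (sigma₁ t x * sigma₃ t) := by ring
    rw [sigma₂, e1, e2, hθ, hσsq, hab, hac, hbc, div_eq_iff]
    · linear_combination (8 * (A + B + C + A * B * C) ^ 2) * hflex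
    · have : 4 + 4 * ((A + B + C + A * B * C) ^ 2 - 1) = 4 * (A + B + C + A * B * C) ^ 2 := by ring
      rw [this]
      exact mul_ne_zero (by norm_num) (pow_ne_zero 2 hq0)
  refine ⟨a, b, c, A, B, C, ⟨ht, by linarith, by linarith, by linarith, habc, habc ▸ hσ0, hflex, hq,
    hA0, hB0, hC0, hAB, hAC, hBC, hσ₁, hσ₂⟩, he₁, he₃⟩

/-- E'' is Y² = (U + A²)(U + B²)(U + C²) with U rescaled by (t/s)². As e₂ = 0, its coefficients are
polynomials in e₁ and e₃, which are rational functions of t and x. -/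
theorem hasRoots_curveE'' {t x y g h : ℚ} (ht : t ≠ 0) (ht₁ : t ≠ 1) (ht₂ : t ≠ -1) (hx : x ≠ 0)
    (hy : y ≠ 0) (hc : IsCubic t x y g h) :
    ∃ e₁ e₂ e₃, HasRoots (curveE'' t x) e₁ e₂ e₃ ∧ e₁ ≠ e₂ ∧ e₁ ≠ e₃ ∧ e₂ ≠ e₃ := by
  obtain ⟨a, b, c, A, B, C, d, he₁, he₃⟩ := exists_tripleData ht ht₁ ht₂ hx hy hc
  set s := t ^ 2 + 1 with hs
  have hs0 : s ≠ 0 := by positivity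
  have hts : -(t / s) ^ 2 ≠ 0 := neg_ne_zero.mpr (pow_ne_zero 2 (div_ne_zero ht hs0))
  have hsumsq : A ^ 2 + B ^ 2 + C ^ 2 = (A + B + C) ^ 2 := by linear_combination -2 * d.flex
  have hprodsq : A ^ 2 * B ^ 2 + A ^ 2 * C ^ 2 + B ^ 2 * C ^ 2 =
      -2 * ((A + B + C) * (A * B * C)) := by
    linear_combination (A * B + A * C + B * C) * d.flex
  refine ⟨-(t / s) ^ 2 * A ^ 2, -(t / s) ^ 2 * B ^ 2, -(t / s) ^ 2 * C ^ 2,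
    ⟨isShort_curveE'' t x, ?_, ?_, ?_⟩, fun e => d.AB (mul_left_cancel₀ hts e),
    fun e => d.AC (mul_left_cancel₀ hts e), fun e => d.BC (mul_left_cancel₀ hts e)⟩
  · have : -(-(t / s) ^ 2 * A ^ 2 + -(t / s) ^ 2 * B ^ 2 + -(t / s) ^ 2 * C ^ 2) =
        (t / s) ^ 2 * (A ^ 2 + B ^ 2 + C ^ 2) := by ring
    rw [this, hsumsq, he₁]
    simp only [curveE'', ← hs]
    field_simp
    ring
  · have : -(t / s) ^ 2 * A ^ 2 * (-(t / s) ^ 2 * B ^ 2) +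
        -(t / s) ^ 2 * A ^ 2 * (-(t / s) ^ 2 * C ^ 2) +
        -(t / s) ^ 2 * B ^ 2 * (-(t / s) ^ 2 * C ^ 2) =
        (t / s) ^ 4 * (A ^ 2 * B ^ 2 + A ^ 2 * C ^ 2 + B ^ 2 * C ^ 2) := by ring
    rw [this, hprodsq, he₁, he₃]
    simp only [curveE'', ← hs]
    field_simp
    ring
  · have : -(-(t / s) ^ 2 * A ^ 2 * (-(t / s) ^ 2 * B ^ 2) * (-(t / s) ^ 2 * C ^ 2)) =
        (t / s) ^ 6 * (A * B * C) ^ 2 := by ring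
    rw [this, he₃]
    simp only [curveE'', ← hs]
    field_simp
    ring

namespace TripleData

variable {t x a b c A B C : ℚ}

theorem hasRoots (d : TripleData t x a b c A B C) :
    HasRoots (curveE' t x) (-(a * b)) (-(a * c)) (-(b * c)) := by
  refine ⟨isShort_curveE' t x, ?_, ?_, ?_⟩
  · simp only [curveE', d.sigma₂_eq]; ring
  · simp only [curveE', d.sigma₁_eq, ← d.abc]; ring
  · simp only [curveE', ← d.abc]; ring

theorem ab_ne_ac (d : TripleData t x a b c A B C) : a * b ≠ a * c := fun e =>
  d.AB (by rw [← d.ab, ← d.ac, e])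

theorem ab_ne_bc (d : TripleData t x a b c A B C) : a * b ≠ b * c := fun e =>
  d.AC (by rw [← d.ab, ← d.bc, e])

theorem ac_ne_bc (d : TripleData t x a b c A B C) : a * c ≠ b * c := fun e =>
  d.BC (by rw [← d.ac, ← d.bc, e])

theorem nonsingular (d : TripleData t x a b c A B C) {X Y : ℚ}
    (h : Y ^ 2 = (X + a * b) * (X + a * c) * (X + b * c)) : (curveE' t x).Nonsingular X Y :=
  d.hasRoots.nonsingular (neg_injective.ne d.ab_ne_ac) (neg_injective.ne d.ab_ne_bc)
    (neg_injective.ne d.ac_ne_bc) (by rw [h]; ring)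

theorem tripleCubic_eq (d : TripleData t x a b c A B C) :
    tripleCubic t x = (X - Polynomial.C a) * (X - Polynomial.C b) * (X - Polynomial.C c) := by
  rw [tripleCubic, d.sigma₁_eq, d.sigma₂_eq, ← d.abc]
  simp only [map_add, map_mul]
  ring

theorem a_ne_b (d : TripleData t x a b c A B C) : a ≠ b := fun e => d.ac_ne_bc (by rw [e])

theorem a_ne_c (d : TripleData t x a b c A B C) : a ≠ c := fun e =>
  d.ab_ne_bc (by rw [e]; ring)

theorem b_ne_c (d : TripleData t x a b c A B C) : b ≠ c := fun e => d.ab_ne_ac (by rw [e])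

theorem a_ne_zero (d : TripleData t x a b c A B C) : a ≠ 0 :=
  left_ne_zero_of_mul (left_ne_zero_of_mul d.abc_ne)

theorem b_ne_zero (d : TripleData t x a b c A B C) : b ≠ 0 :=
  right_ne_zero_of_mul (left_ne_zero_of_mul d.abc_ne)

theorem c_ne_zero (d : TripleData t x a b c A B C) : c ≠ 0 := right_ne_zero_of_mul d.abc_ne

theorem isSquare_ab (d : TripleData t x a b c A B C) : IsSquare (a * b + 1) :=
  d.ab ▸ IsSquare.sq A

theorem isSquare_ac (d : TripleData t x a b c A B C) : IsSquare (a * c + 1) :=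
  d.ac ▸ IsSquare.sq B

theorem isSquare_bc (d : TripleData t x a b c A B C) : IsSquare (b * c + 1) :=
  d.bc ▸ IsSquare.sq C

theorem isRationalDiophantineTuple (d : TripleData t x a b c A B C) :
    IsRationalDiophantineTuple 3 {a, b, c} := by
  have sab := d.isSquare_ab
  have sac := d.isSquare_ac
  have sbc := d.isSquare_bc
  refine ⟨Finset.card_eq_three.mpr ⟨a, b, c, d.a_ne_b, d.a_ne_c, d.b_ne_c, rfl⟩, ?_, ?_⟩
  · simp [d.a_ne_zero.symm, d.b_ne_zero.symm, d.c_ne_zero.symm]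
  · intro u hu v hv huv
    simp only [Finset.mem_insert, Finset.mem_singleton] at hu hv
    rcases hu with rfl | rfl | rfl <;> rcases hv with rfl | rfl | rfl <;>
      first | exact absurd rfl huv | assumption | (rw [mul_comm]; assumption)

end TripleData

/-! ### 2-descent and fibres of the x-coordinate -/

section Coordinates

variable {W : WeierstrassCurve.Affine ℚ}

theorem LineMeets.sub_root {e₁ e₂ e₃ L M x₁ x₂ x₃ : ℚ} (hl : LineMeets W L M x₁ x₂ x₃)
    (h : HasRoots W e₁ e₂ e₃) : (x₁ - e₁) * (x₂ - e₁) * (x₃ - e₁) = (L * e₁ + M) ^ 2 := by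
  have := hl.eval e₁
  rw [h.a₂_eq, h.a₄_eq, h.a₆_eq] at this
  linear_combination this

/-- On the tangent at a point over x₁, (x₁ - e₁)²(x - e₁) is the square of the value of the line at
e₁. -/
theorem HasRoots.exists_sq_of_double {e₁ e₂ e₃ : ℚ} (h : HasRoots W e₁ e₂ e₃) {Q : W.Point}
    {x y : ℚ} {hxy : W.Nonsingular x y} (hQ : 2 • Q = .some x y hxy) : ∃ r, x - e₁ = r ^ 2 := by
  cases Q with
  | zero =>
    rw [← WeierstrassCurve.Affine.Point.zero_def, nsmul_zero] at hQ
    exact absurd hQ.symm (WeierstrassCurve.Affine.Point.some_ne_zero hxy)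
  | some x₁ y₁ h₁ =>
    have hy : y₁ ≠ 0 := by
      rintro rfl
      rw [(h.short.two_nsmul_eq_zero_iff h₁).mpr rfl] at hQ
      exact absurd hQ.symm (WeierstrassCurve.Affine.Point.some_ne_zero hxy)
    obtain ⟨L, M, x', y', h', e, -, -, hl, -⟩ := h.short.exists_double h₁ hy
    rw [hQ, WeierstrassCurve.Affine.Point.some.injEq] at e
    have hx₁ : x₁ - e₁ ≠ 0 := by
      intro h0
      have := (h.equation_iff x₁ y₁).mp h₁.1
      rw [h0, zero_mul, zero_mul] at this
      exact hy (pow_eq_zero_iff two_ne_zero |>.mp this)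
    refine ⟨(L * e₁ + M) / (x₁ - e₁), ?_⟩
    have := hl.sub_root h
    rw [← e.1] at this
    rw [div_pow, ← this]
    field_simp

/-- The class of x - e₁ modulo squares is unchanged by adding a double. The hypothesis `hQ` keeps
[2]Q from being a point of order two, where x - e₁ could vanish. -/
theorem HasRoots.exists_sq_of_add_double {e₁ e₂ e₃ : ℚ} (h : HasRoots W e₁ e₂ e₃)
    {Q : W.Point} (hQ : 2 • (2 • Q) = 0 → 2 • Q = 0) {x₀ y₀ x y : ℚ} {h₀ : W.Nonsingular x₀ y₀}
    {hxy : W.Nonsingular x y} (he : WeierstrassCurve.Affine.Point.some x₀ y₀ h₀ + 2 • Q =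
      .some x y hxy) (hx₀ : x₀ ≠ e₁) : ∃ r, x - e₁ = (x₀ - e₁) * r ^ 2 := by
  rcases hD : 2 • Q with _ | ⟨x₁, y₁, h₁⟩
  · rw [hD, ← WeierstrassCurve.Affine.Point.zero_def, add_zero,
      WeierstrassCurve.Affine.Point.some.injEq] at he
    exact ⟨1, by rw [he.1]; ring⟩
  · obtain ⟨r, hr⟩ := h.exists_sq_of_double hD
    have hy : y₁ ≠ 0 := by
      intro h0
      rw [hD] at hQ
      exact WeierstrassCurve.Affine.Point.some_ne_zero h₁
        (hQ ((h.short.two_nsmul_eq_zero_iff h₁).mpr h0))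
    have hx₁ : x₁ - e₁ ≠ 0 := by
      intro h0
      have := (h.equation_iff x₁ y₁).mp h₁.1
      rw [h0, zero_mul, zero_mul] at this
      exact hy (pow_eq_zero_iff two_ne_zero |>.mp this)
    have hr0 : r ≠ 0 := by
      rintro rfl
      exact hx₁ (by rw [hr]; norm_num)
    rw [hD] at he
    have hne : ¬(x₀ = x₁ ∧ y₀ = -y₁) := by
      rintro ⟨rfl, h2⟩
      rw [h.short.some_add_eq_zero h₀ h₁ h2] at he
      exact WeierstrassCurve.Affine.Point.some_ne_zero hxy he.symm
    obtain ⟨L, M, x₃, y₃, h₃, e, -, -, -, hl, -⟩ := h.short.exists_line h₀ h₁ hne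
    rw [he, WeierstrassCurve.Affine.Point.some.injEq] at e
    have := hl.sub_root h
    rw [← e.1, hr] at this
    have hx₀' : x₀ - e₁ ≠ 0 := sub_ne_zero.mpr hx₀
    refine ⟨(L * e₁ + M) / ((x₀ - e₁) * r), ?_⟩
    rw [div_pow, ← this]
    field_simp

theorem eq_or_eq_neg_of_xCoord_eq {P Q : W.Point} (hP : P ≠ 0) (hQ : Q ≠ 0)
    (h : xCoord P = xCoord Q) : P = Q ∨ P = -Q := by
  cases P with
  | zero => exact absurd rfl hP
  | some x₁ y₁ h₁ =>
  cases Q with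
  | zero => exact absurd rfl hQ
  | some x₂ y₂ h₂ => exact WeierstrassCurve.Affine.Point.X_eq_iff.mp h

theorem finite_setOf_xCoord_eq {U : ℕ → W.Point} (hU : Function.Injective U) (h0 : ∀ n, U n ≠ 0)
    (v : ℚ) : {n | xCoord (U n) = v}.Finite := by
  by_cases hv : ∃ k, xCoord (U k) = v
  · obtain ⟨k, hk⟩ := hv
    have : {n | xCoord (U n) = v} ⊆ U ⁻¹' {U k, -U k} := by
      intro n hn
      exact eq_or_eq_neg_of_xCoord_eq (h0 n) (h0 k) (hn.trans hk.symm)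
    exact (Set.Finite.preimage hU.injOn (by simp)).subset this
  · push Not at hv
    have : {n | xCoord (U n) = v} = ∅ := by
      ext n
      simpa using hv n
    rw [this]
    exact Set.finite_empty

end Coordinates

/-! ### The curve E' and the squares it provides -/

namespace TripleData

variable {t x a b c A B C ρ : ℚ}

theorem rho_sq (d : TripleData t x a b c A B C)
    (hρ : ρ ^ 2 = (a * b + 1) * (a * c + 1) * (b * c + 1)) : ρ ^ 2 = (A * B * C) ^ 2 := by
  rw [hρ, d.ab, d.ac, d.bc]; ring

theorem rho_ne_zero (d : TripleData t x a b c A B C)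
    (hρ : ρ ^ 2 = (a * b + 1) * (a * c + 1) * (b * c + 1)) : ρ ≠ 0 := by
  rintro rfl
  have := d.rho_sq hρ
  rw [zero_pow two_ne_zero] at this
  exact pow_ne_zero 2 (mul_ne_zero (mul_ne_zero d.A_ne d.B_ne) d.C_ne) this.symm

/-- Because e₂ = 0, a₂ and a₄ depend on e₁ and e₃ alone; expand U³ + (e₁U - e₃)² at U = X - 1. -/
theorem a₂_eq (d : TripleData t x a b c A B C) :
    (curveE' t x).a₂ = (A + B + C) ^ 2 - 3 := by
  simp only [curveE', d.sigma₂_eq]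
  linear_combination d.ab + d.ac + d.bc - 2 * d.flex

theorem a₄_eq (d : TripleData t x a b c A B C) :
    (curveE' t x).a₄ = 3 - 2 * (A + B + C + A * B * C) * (A + B + C) := by
  have hab : a * b = A ^ 2 - 1 := by linarith [d.ab]
  have hac : a * c = B ^ 2 - 1 := by linarith [d.ac]
  have hbc : b * c = C ^ 2 - 1 := by linarith [d.bc]
  have : (curveE' t x).a₄ = a * b * (a * c) + a * b * (b * c) + a * c * (b * c) := by
    simp only [curveE', d.sigma₁_eq, ← d.abc]
    ring
  rw [this, hab, hac, hbc]
  linear_combination (A * B + A * C + B * C + 4) * d.flex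

theorem a₆_eq (d : TripleData t x a b c A B C) : (curveE' t x).a₆ = (a * b * c) ^ 2 := by
  simp only [curveE', ← d.abc]

/-- The tangent at X = 1 has slope ±e₁, and L² = e₁² puts its third intersection at X = 1 again: a
flex. -/
theorem three_nsmul_eq_zero (d : TripleData t x a b c A B C)
    (hρ : ρ ^ 2 = (a * b + 1) * (a * c + 1) * (b * c + 1)) (hS : (curveE' t x).Nonsingular 1 ρ) :
    3 • (WeierstrassCurve.Affine.Point.some 1 ρ hS) = 0 := by
  have hW := isShort_curveE' t x
  have hρ0 := d.rho_ne_zero hρ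
  have hρ2 := d.rho_sq hρ
  obtain ⟨L, M, x', y', h', e, e1, e2, hl, e3⟩ := hW.exists_double hS hρ0
  have hL : L * ρ = -(A + B + C) * (A * B * C) := by
    rw [d.a₂_eq, d.a₄_eq] at e3
    linear_combination e3 / 2
  have hL2 : L ^ 2 = (A + B + C) ^ 2 := by
    apply mul_right_cancel₀ (pow_ne_zero 2 hρ0)
    rw [← mul_pow, hL, hρ2]; ring
  have hx' : x' = 1 := by
    have := hl.a₂_eq
    rw [d.a₂_eq, hL2] at this
    linarith
  have hy' : y' = -ρ := by rw [hx'] at e2; linarith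
  subst hx' hy'
  rw [succ_nsmul, e]
  exact hW.some_add_eq_zero h' hS rfl

/-- A line y = Lx + M through points over x₁, 1, x₃ satisfies x₁x₃ = M² - a₆, and a₆ = (abc)². -/
theorem xCoord_mul_add_sq (d : TripleData t x a b c A B C)
    {hS : (curveE' t x).Nonsingular 1 ρ} {U V : (curveE' t x).Point} (hU : U ≠ 0) (hV : V ≠ 0)
    (h : U + .some 1 ρ hS = V) :
    IsSquare (xCoord U / (a * b * c) * (xCoord V / (a * b * c)) + 1) := by
  have hW := isShort_curveE' t x
  cases U with
  | zero => exact absurd rfl hU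
  | some x₁ y₁ h₁ =>
  have hne : ¬(x₁ = 1 ∧ y₁ = -ρ) := by
    rintro ⟨rfl, h2⟩
    exact hV (h ▸ hW.some_add_eq_zero h₁ hS h2)
  obtain ⟨L, M, x₃, y₃, h₃, e, -, -, -, hl, -⟩ := hW.exists_line h₁ hS hne
  rw [← h, e]
  refine ⟨M / (a * b * c), ?_⟩
  have h6 := hl.a₆_eq
  rw [d.a₆_eq] at h6
  have h0 := d.abc_ne
  simp only [xCoord]
  rw [div_mul_div_comm, div_mul_div_comm, div_add_one (mul_ne_zero h0 h0)]
  congr 1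
  linear_combination h6

/-- Since x(P') = 0, descent gives x(U) + ab = ab·r², that is c·x(U)/(abc) + 1 = r²; similarly for
the other two roots. -/
theorem isSquare_mul_xCoord (d : TripleData t x a b c A B C)
    {hP : (curveE' t x).Nonsingular 0 (a * b * c)} {Q U : (curveE' t x).Point}
    (hQ : 2 • (2 • Q) = 0 → 2 • Q = 0) (hU : U ≠ 0)
    (h : WeierstrassCurve.Affine.Point.some 0 (a * b * c) hP + 2 • Q = U) :
    IsSquare (a * (xCoord U / (a * b * c)) + 1) ∧ IsSquare (b * (xCoord U / (a * b * c)) + 1) ∧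
      IsSquare (c * (xCoord U / (a * b * c)) + 1) := by
  have h0 := d.abc_ne
  have ha := d.a_ne_zero
  have hb := d.b_ne_zero
  have hc := d.c_ne_zero
  cases U with
  | zero => exact absurd rfl hU
  | some x₁ y₁ h₁ =>
  have n : ∀ {u v : ℚ}, u ≠ 0 → v ≠ 0 → (0 : ℚ) ≠ -(u * v) := fun hu hv =>
    (neg_ne_zero.mpr (mul_ne_zero hu hv)).symm
  obtain ⟨r₁, e₁⟩ := d.hasRoots.exists_sq_of_add_double hQ h (n ha hb)
  obtain ⟨r₂, e₂⟩ := d.hasRoots.rotate.exists_sq_of_add_double hQ h (n ha hc)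
  obtain ⟨r₃, e₃⟩ := d.hasRoots.rotate.rotate.exists_sq_of_add_double hQ h (n hb hc)
  simp only [xCoord]
  refine ⟨⟨r₃, ?_⟩, ⟨r₂, ?_⟩, ⟨r₁, ?_⟩⟩
  · field_simp; linear_combination e₃
  · field_simp; linear_combination e₂
  · field_simp; linear_combination e₁

end TripleData

/-! ### From a point of infinite order to sextuples -/

namespace TripleData

variable {t x a b c A B C ρ : ℚ}

theorem isRationalDiophantineTuple_extendedSet (d : TripleData t x a b c A B C)
    {hP : (curveE' t x).Nonsingular 0 (a * b * c)} {hS : (curveE' t x).Nonsingular 1 ρ}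
    (hinf : ∀ n : ℕ, n ≠ 0 → n • (WeierstrassCurve.Affine.Point.some 0 (a * b * c) hP) ≠ 0)
    (h3 : 3 • (WeierstrassCurve.Affine.Point.some 1 ρ hS) = 0) {n : ℕ}
    {T : (curveE' t x).Point}
    (hT : T = (2 * n + 1) • WeierstrassCurve.Affine.Point.some 0 (a * b * c) hP)
    (hgood : ∀ U ∈ ({T, T + .some 1 ρ hS, T - .some 1 ρ hS} : Set (curveE' t x).Point),
      xCoord U ∉ ({0, a * (a * b * c), b * (a * b * c), c * (a * b * c)} : Set ℚ)) :
    IsRationalDiophantineTuple 6 (extendedSet a b c T (.some 1 ρ hS)) := by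
  obtain ⟨P, hPdef⟩ : ∃ P, P = WeierstrassCurve.Affine.Point.some 0 (a * b * c) hP := ⟨_, rfl⟩
  obtain ⟨S, hSdef⟩ : ∃ S, S = WeierstrassCurve.Affine.Point.some 1 ρ hS := ⟨_, rfl⟩
  have hS0 : S ≠ 0 := hSdef ▸ WeierstrassCurve.Affine.Point.some_ne_zero hS
  rw [← hPdef] at hinf hT
  rw [← hSdef] at h3 hgood ⊢
  have h0 := d.abc_ne
  have hkT : ∀ k : ℕ, k ≠ 0 → k • T ≠ 0 := by
    intro k hk
    rw [hT, ← mul_nsmul']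
    exact hinf _ (Nat.mul_ne_zero hk (by omega))
  have hT0 : T ≠ 0 := by simpa using hkT 1 one_ne_zero
  have hTS : T + S ≠ 0 := by
    intro h
    apply hkT 3 (by norm_num)
    have : 3 • T = 3 • (T + S) - 3 • S := by abel
    rw [this, h, h3]; simp
  have hTS' : T - S ≠ 0 := by
    intro h
    apply hkT 3 (by norm_num)
    have : 3 • T = 3 • (T - S) + 3 • S := by abel
    rw [this, h, h3]; simp
  have ne₁ : xCoord T ≠ xCoord (T + S) := by
    intro h
    rcases eq_or_eq_neg_of_xCoord_eq hT0 hTS h with h | h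
    · exact hS0 (by simpa using h)
    · apply hkT 6 (by norm_num)
      have : 6 • T = 3 • (T - (-(T + S))) - 3 • S := by abel
      rw [this, sub_eq_zero.mpr h, h3]; simp
  have ne₂ : xCoord T ≠ xCoord (T - S) := by
    intro h
    rcases eq_or_eq_neg_of_xCoord_eq hT0 hTS' h with h | h
    · exact hS0 (by rw [eq_sub_iff_add_eq] at h; simpa using h)
    · apply hkT 6 (by norm_num)
      have : 6 • T = 3 • (T - (-(T - S))) + 3 • S := by abel
      rw [this, sub_eq_zero.mpr h, h3]; simp
  have ne₃ : xCoord (T + S) ≠ xCoord (T - S) := by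
    intro h
    rcases eq_or_eq_neg_of_xCoord_eq hTS hTS' h with h | h
    · apply hS0
      have : S = 3 • S - ((T + S) - (T - S)) := by abel
      rw [this, sub_eq_zero.mpr h, h3]; simp
    · apply hkT 2 (by norm_num)
      have : 2 • T = (T + S) - (-(T - S)) := by abel
      rw [this, sub_eq_zero.mpr h]
  -- The group generated by P' and S has no element of order 4, as P' has infinite order and S has
  -- order three.
  have hquad : ∀ Q : (curveE' t x).Point, (∃ j : ℕ, ∃ k : ℤ, Q = j • P + k • S) →
      2 • (2 • Q) = 0 → 2 • Q = 0 := by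
    rintro Q ⟨j, k, rfl⟩ h
    have h3k : 3 • (k • S) = 0 := by rw [smul_comm, h3, zsmul_zero]
    have hj : j = 0 := by
      by_contra hj
      apply hinf (12 * j) (by omega)
      have : (12 * j) • P = 3 • (2 • (2 • (j • P + k • S))) - 4 • (3 • (k • S)) := by
        rw [mul_nsmul']; abel
      rw [this, h, h3k]; simp
    subst hj
    have : 2 • ((0 : ℕ) • P + k • S) = 2 • (3 • (k • S)) - 2 • (2 • ((0 : ℕ) • P + k • S)) := by
      rw [zero_nsmul]; abel
    rw [this, h, h3k]; simp
  have q₀ := d.isSquare_mul_xCoord (hP := hP) (Q := n • P) (U := T)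
    (hquad _ ⟨n, 0, by simp⟩) hT0 (by rw [← hPdef, hT, add_nsmul, mul_nsmul', one_nsmul, add_comm])
  -- As [3]S = O, adding S is subtracting [2]S, so T + S and T - S also are P' plus a double.
  have q₁ := d.isSquare_mul_xCoord (hP := hP) (Q := n • P - S) (U := T + S)
    (hquad _ ⟨n, -1, by rw [neg_one_zsmul, sub_eq_add_neg]⟩) hTS (by
      have : T + S = T - 2 • S + 3 • S := by abel
      rw [← hPdef, this, h3, hT, add_nsmul, mul_nsmul', one_nsmul]; abel)
  have q₂ := d.isSquare_mul_xCoord (hP := hP) (Q := n • P + S) (U := T - S)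
    (hquad _ ⟨n, 1, by rw [one_zsmul]⟩) hTS' (by
      have : T - S = T + 2 • S - 3 • S := by abel
      rw [← hPdef, this, h3, hT, add_nsmul, mul_nsmul', one_nsmul]; abel)
  have q₀₁ := d.xCoord_mul_add_sq (hS := hS) hT0 hTS (by rw [← hSdef])
  have q₂₀ := d.xCoord_mul_add_sq (hS := hS) hTS' hT0 (by rw [← hSdef]; abel)
  have q₁₂ := d.xCoord_mul_add_sq (hS := hS) hTS hTS' (by
    have : T - S = (T + S) + S - 3 • S := by abel
    rw [← hSdef, this, h3, sub_zero])
  have hdiv : ∀ U ∈ ({T, T + S, T - S} : Set (curveE' t x).Point),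
      xCoord U / (a * b * c) ≠ 0 ∧ xCoord U / (a * b * c) ≠ a ∧ xCoord U / (a * b * c) ≠ b ∧
        xCoord U / (a * b * c) ≠ c := by
    intro U hU
    have := hgood U hU
    simp only [Set.mem_insert_iff, Set.mem_singleton_iff, not_or] at this
    simp only [ne_eq, div_eq_iff h0, zero_mul]
    exact this
  obtain ⟨g₀, a₀, b₀, c₀⟩ := hdiv T (by simp)
  obtain ⟨g₁, a₁, b₁, c₁⟩ := hdiv (T + S) (by simp)
  obtain ⟨g₂, a₂, b₂, c₂⟩ := hdiv (T - S) (by simp)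
  have hinj : ∀ {u v : ℚ}, u ≠ v → u / (a * b * c) ≠ v / (a * b * c) := fun h e =>
    h ((div_left_inj' h0).mp e)
  have ne₁' := hinj ne₁
  have ne₂' := hinj ne₂
  have ne₃' := hinj ne₃
  have sab := d.isSquare_ab
  have sac := d.isSquare_ac
  have sbc := d.isSquare_bc
  obtain ⟨qa₀, qb₀, qc₀⟩ := q₀
  obtain ⟨qa₁, qb₁, qc₁⟩ := q₁
  obtain ⟨qa₂, qb₂, qc₂⟩ := q₂
  rw [extendedSet]
  generalize xCoord T / (a * b * c) = u₀ at *
  generalize xCoord (T + S) / (a * b * c) = u₁ at *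
  generalize xCoord (T - S) / (a * b * c) = u₂ at *
  refine ⟨?_, ?_, ?_⟩
  · rw [Finset.card_insert_of_notMem, Finset.card_insert_of_notMem, Finset.card_insert_of_notMem,
      Finset.card_insert_of_notMem, Finset.card_pair ne₃']
    · simp [ne₁', ne₂']
    · simp [c₀.symm, c₁.symm, c₂.symm]
    · simp [b₀.symm, b₁.symm, b₂.symm, d.b_ne_c]
    · simp [a₀.symm, a₁.symm, a₂.symm, d.a_ne_b, d.a_ne_c]
  · simp [d.a_ne_zero.symm, d.b_ne_zero.symm, d.c_ne_zero.symm, g₀.symm, g₁.symm, g₂.symm]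
  · clear * - sab sac sbc qa₀ qb₀ qc₀ qa₁ qb₁ qc₁ qa₂ qb₂ qc₂ q₀₁ q₂₀ q₁₂
    intro u hu v hv huv
    simp only [Finset.mem_insert, Finset.mem_singleton] at hu hv
    rcases hu with rfl | rfl | rfl | rfl | rfl | rfl <;>
      rcases hv with rfl | rfl | rfl | rfl | rfl | rfl <;>
      first | exact absurd rfl huv | assumption | (rw [mul_comm]; assumption)

/-- Each x-coordinate is shared by at most two points, so only finitely many n hit one of the four
forbidden values. If only finitely many sextuples arose, x(T) would take finitely many values on all
but finitely many n, against the same finiteness. -/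
theorem finite_not_and_infinite (d : TripleData t x a b c A B C)
    {hP : (curveE' t x).Nonsingular 0 (a * b * c)} {hS : (curveE' t x).Nonsingular 1 ρ}
    (hinf : ∀ n : ℕ, n ≠ 0 → n • (WeierstrassCurve.Affine.Point.some 0 (a * b * c) hP) ≠ 0)
    (h3 : 3 • (WeierstrassCurve.Affine.Point.some 1 ρ hS) = 0) :
    {n : ℕ | ¬ IsRationalDiophantineTuple 6 (extendedSet a b c
      ((2 * n + 1) • WeierstrassCurve.Affine.Point.some 0 (a * b * c) hP) (.some 1 ρ hS))}.Finite ∧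
    {s : Finset ℚ | IsRationalDiophantineTuple 6 s ∧ ∃ n : ℕ, s = extendedSet a b c
      ((2 * n + 1) • WeierstrassCurve.Affine.Point.some 0 (a * b * c) hP)
      (.some 1 ρ hS)}.Infinite := by
  obtain ⟨T, hT⟩ : ∃ T : ℕ → (curveE' t x).Point, ∀ n, T n =
    (2 * n + 1) • WeierstrassCurve.Affine.Point.some 0 (a * b * c) hP := ⟨_, fun _ => rfl⟩
  simp only [← hT]
  have hTinj : Function.Injective T := by
    have hle : ∀ i j, i ≤ j → T i = T j → i = j := by
      intro i j hij h
      by_contra hne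
      rw [hT, hT] at h
      apply hinf (2 * (j - i)) (by omega)
      have h2 : 2 * j + 1 = 2 * (j - i) + (2 * i + 1) := by omega
      rw [h2, add_nsmul _ (2 * (j - i))] at h
      exact left_eq_add.mp (h.trans (add_comm _ _))
    intro i j h
    rcases le_total i j with hij | hij
    · exact hle i j hij h
    · exact (hle j i hij h.symm).symm
  have hT3 : ∀ n, 3 • T n ≠ 0 := by
    intro n
    rw [hT, ← mul_nsmul']
    exact hinf _ (by omega)
  have hfin : ∀ V : (curveE' t x).Point, 3 • V = 0 → ∀ v : ℚ,
      {n | xCoord (T n + V) = v}.Finite := by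
    intro V hV v
    refine finite_setOf_xCoord_eq (U := fun n => T n + V) (fun i j h => hTinj ?_) (fun n h => ?_) v
    · exact add_right_cancel h
    · apply hT3 n
      have h' : T n + V = 0 := h
      have : 3 • T n = 3 • (T n + V) - 3 • V := by abel
      rw [this, h', hV]; simp
  have hbad : {n : ℕ | ¬ IsRationalDiophantineTuple 6
      (extendedSet a b c (T n) (.some 1 ρ hS))}.Finite := by
    have hF : ∀ V : (curveE' t x).Point, 3 • V = 0 →
        {n | xCoord (T n + V) ∈
          ({0, a * (a * b * c), b * (a * b * c), c * (a * b * c)} : Set ℚ)}.Finite := by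
      intro V hV
      have : {n | xCoord (T n + V) ∈
          ({0, a * (a * b * c), b * (a * b * c), c * (a * b * c)} : Set ℚ)} =
          ⋃ v ∈ ({0, a * (a * b * c), b * (a * b * c), c * (a * b * c)} : Set ℚ),
            {n | xCoord (T n + V) = v} := by
        ext n; simp
      rw [this]
      exact Set.Finite.biUnion (by simp) (fun v _ => hfin V hV v)
    refine ((hF 0 (by simp)).union ((hF _ h3).union
      (hF (-.some 1 ρ hS) (by rw [neg_nsmul, h3, neg_zero])))).subset ?_
    intro n hn
    by_contra hcon
    apply hn
    refine d.isRationalDiophantineTuple_extendedSet hinf h3 (hT n) ?_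
    simp only [Set.mem_union, Set.mem_ofPred_eq, not_or, add_zero, ← sub_eq_add_neg] at hcon
    intro U hU
    simp only [Set.mem_insert_iff, Set.mem_singleton_iff] at hU
    rcases hU with rfl | rfl | rfl
    · exact hcon.1
    · exact hcon.2.1
    · exact hcon.2.2
  refine ⟨hbad, fun hfinite => ?_⟩
  have hfib : ∀ v : ℚ, {n | xCoord (T n) / (a * b * c) = v}.Finite := by
    intro v
    refine (hfin 0 (by simp) (v * (a * b * c))).subset ?_
    intro n hn
    rw [Set.mem_ofPred_eq, div_eq_iff d.abc_ne] at hn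
    simpa using hn
  have hcover : (Set.univ : Set ℕ) ⊆ {n : ℕ | ¬ IsRationalDiophantineTuple 6
      (extendedSet a b c (T n) (.some 1 ρ hS))} ∪
      ⋃ s ∈ {s : Finset ℚ | IsRationalDiophantineTuple 6 s ∧
        ∃ n : ℕ, s = extendedSet a b c (T n) (.some 1 ρ hS)},
      ⋃ v ∈ s, {n | xCoord (T n) / (a * b * c) = v} := by
    intro n _
    by_cases hn : IsRationalDiophantineTuple 6 (extendedSet a b c (T n) (.some 1 ρ hS))
    · right
      simp only [Set.mem_iUnion]
      exact ⟨_, ⟨hn, n, rfl⟩, xCoord (T n) / (a * b * c), by simp [extendedSet], rfl⟩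
    · left; exact hn
  refine Set.infinite_univ ((hbad.union (hfinite.biUnion fun s _ => ?_)).subset hcover)
  exact Set.Finite.biUnion s.finite_toSet (fun v _ => hfib v)

end TripleData

/-! ### Infinite order of P': primes dividing t² - 1 -/

namespace TripleData

variable {t x a b c A B C : ℚ}

theorem exists_double_P (d : TripleData t x a b c A B C)
    (hP : (curveE' t x).Nonsingular 0 (a * b * c)) :
    ∃ X Y h, 2 • (WeierstrassCurve.Affine.Point.some 0 (a * b * c) hP) = .some X Y h ∧
      X = (curveE' t x).a₄ ^ 2 / (4 * (a * b * c) ^ 2) - (curveE' t x).a₂ := by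
  have h0 := d.abc_ne
  obtain ⟨L, M, X, Y, h, e, -, -, hl, hL⟩ := (isShort_curveE' t x).exists_double hP h0
  refine ⟨X, Y, h, e, ?_⟩
  have : L = (curveE' t x).a₄ / (2 * (a * b * c)) := by
    rw [eq_div_iff (mul_ne_zero two_ne_zero h0)]
    linear_combination hL
  rw [hl.a₂_eq, this]
  field_simp
  ring

theorem four_mul_a₂ (d : TripleData t x a b c A B C) (hq : (t ^ 2 + 1) / (2 * t) ≠ 0) :
    4 * (curveE' t x).a₂ = ((3 - (curveE' t x).a₄) / ((t ^ 2 + 1) / (2 * t))) ^ 2 - 12 := by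
  rw [d.a₂_eq, d.a₄_eq, d.sum_add_prod]
  generalize (t ^ 2 + 1) / (2 * t) = q at hq
  field_simp
  ring

variable {p : ℕ} [Fact p.Prime]

/-- With θ = a₄ and scaling 2/θ the curve is integral, while x([2]P') = θ²/(4σ₃²) - a₂ becomes 1/σ₃²
plus an integral term, hence not integral. The argument covers p = 2 as well. -/
theorem nsmul_P_ne_zero_of_one_le (d : TripleData t x a b c A B C)
    {hP : (curveE' t x).Nonsingular 0 (a * b * c)}
    (hq : padicNorm p ((t ^ 2 + 1) / (2 * t)) = 1) (hσ : padicNorm p (a * b * c) < 1)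
    (hθ : 1 ≤ padicNorm p (curveE' t x).a₄) {n : ℕ} (hn : n ≠ 0) :
    n • (WeierstrassCurve.Affine.Point.some 0 (a * b * c) hP) ≠ 0 := by
  have hW := isShort_curveE' t x
  have h0 := d.abc_ne
  have hq0 : (t ^ 2 + 1) / (2 * t) ≠ 0 := by
    intro h; rw [h] at hq; simp at hq
  obtain ⟨X, Y, h, e, hX⟩ := d.exists_double_P hP
  have h4 := d.four_mul_a₂ hq0
  have h6 := d.a₆_eq
  obtain ⟨θ, hθdef⟩ : ∃ θ, θ = (curveE' t x).a₄ := ⟨_, rfl⟩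
  rw [← hθdef] at hθ h4 hX
  have hθ0 : θ ≠ 0 := by
    rintro rfl; simp at hθ; linarith
  have c0 : ∀ k : ℕ, padicNorm p (k : ℚ) ≤ 1 := fun k => padicNorm.of_nat k
  have n4 : padicNorm p (4 * (curveE' t x).a₂ / θ ^ 2) ≤ 1 := by
    rw [padicNorm.div, padicNorm_pow, h4, div_le_one₀ (by positivity)]
    have e1 : padicNorm p (3 - θ) ≤ padicNorm p θ :=
      padicNorm_sub_le ((c0 3).trans hθ) le_rfl
    have e2 : padicNorm p ((3 - θ) / ((t ^ 2 + 1) / (2 * t))) ≤ padicNorm p θ := by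
      rw [padicNorm.div, hq, div_one]; exact e1
    exact padicNorm_sub_le (padicNorm_pow_le e2 2) ((c0 12).trans (one_le_pow₀ hθ))
  have hint : IntegralScaled p (2 / θ) (curveE' t x) := by
    refine ⟨div_ne_zero two_ne_zero hθ0, ?_, ?_, ?_⟩
    · have : (2 / θ) ^ 2 * (curveE' t x).a₂ = 4 * (curveE' t x).a₂ / θ ^ 2 := by
        field_simp; ring
      rw [this]; exact n4
    · have : (2 / θ) ^ 4 * (curveE' t x).a₄ = (16 : ℕ) / θ ^ 3 := by
        rw [← hθdef]; field_simp; norm_num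
      rw [this, padicNorm.div, padicNorm_pow, div_le_one₀ (by positivity)]
      exact (c0 16).trans (one_le_pow₀ hθ)
    · have : (2 / θ) ^ 6 * (curveE' t x).a₆ = (64 : ℕ) * (a * b * c) ^ 2 / θ ^ 6 := by
        rw [h6]; field_simp; push_cast; ring
      rw [this, padicNorm.div, padicNorm_pow θ, div_le_one₀ (by positivity)]
      refine (padicNorm_mul_le (c0 64) (padicNorm_pow_le hσ.le 2)).trans ?_
      rw [one_pow, one_mul]
      exact one_le_pow₀ hθ
  have hbig : 1 < padicNorm p ((2 / θ) ^ 2 * X) := by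
    have : (2 / θ) ^ 2 * X = 1 / (a * b * c) ^ 2 - 4 * (curveE' t x).a₂ / θ ^ 2 := by
      rw [hX]; field_simp; ring
    have hpos : 0 < padicNorm p (a * b * c) := padicNorm_pos h0
    have h1 : 1 < padicNorm p (1 / (a * b * c) ^ 2) := by
      rw [padicNorm.div, padicNorm.one, padicNorm_pow, one_lt_div (by positivity)]
      exact pow_lt_one₀ hpos.le hσ two_ne_zero
    rw [this, padicNorm_sub_eq_of_lt (n4.trans_lt h1)]
    exact h1
  intro hz
  apply nsmul_ne_zero_of_not_integral hW hint h hbig hn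
  rw [← e, smul_comm, hz, nsmul_zero]

/-- Modulo τ = t² - 1 one has a₄ ≡ (x - 8)/x, so a₄ can be small only if x reduces to that of the
singular point of E. A non-integral x makes a₄ a unit. -/
theorem one_le_padicNorm_a₄ (d : TripleData t x a b c A B C) (hp : p ≠ 2)
    (ht : padicNorm p (t ^ 2 - 1) < 1) (hx0 : x ≠ 0) (hx : ¬ padicNorm p (x - 8) < 1) :
    1 ≤ padicNorm p (curveE' t x).a₄ := by
  have c0 : ∀ k : ℕ, padicNorm p (k : ℚ) ≤ 1 := fun k => padicNorm.of_nat k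
  have n2 := padicNorm_two_of_odd_prime hp
  have ht0 := d.t_ne
  have ht1 : t ^ 2 - 1 ≠ 0 := by
    intro h
    have := d.abc
    rw [sigma₃, h, zero_div] at this
    exact d.abc_ne this
  obtain ⟨τ, hτ⟩ : ∃ τ, τ = t ^ 2 - 1 := ⟨_, rfl⟩
  rw [← hτ] at ht
  have nτ := ht.le
  have nt : padicNorm p (t ^ 2) = 1 := by
    have : t ^ 2 = 1 + τ := by rw [hτ]; ring
    rw [this, padicNorm_add_eq_of_lt] <;> rw [padicNorm.one]
    exact ht
  have nx : 0 < padicNorm p x := padicNorm_pos hx0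
  have hθ : (curveE' t x).a₄ * (2 * t ^ 2 * x) =
      (2 + ((2 : ℕ) - τ) * τ) * x - ((2 : ℕ) + τ) ^ 4 := by
    simp only [curveE', sigma₁, sigma₃]
    push_cast
    field_simp
    rw [hτ]; ring
  have hn := congrArg (padicNorm p) hθ
  rw [padicNorm.mul, padicNorm.mul, padicNorm.mul 2, n2, nt, one_mul, one_mul] at hn
  have h2τ : padicNorm p (((2 : ℕ) - τ) * τ) < 1 :=
    padicNorm_mul_lt_one (padicNorm_sub_le (c0 _) nτ) ht
  by_cases hx1 : padicNorm p x ≤ 1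
  · have hx8 : padicNorm p (x - 8) = 1 :=
      le_antisymm (padicNorm_sub_le hx1 (c0 8)) (not_lt.mp hx)
    have hR : (2 + ((2 : ℕ) - τ) * τ) * x - ((2 : ℕ) + τ) ^ 4 = 2 * (x - 8) +
        ((((2 : ℕ) - τ) * x - (τ ^ 3 + (8 : ℕ) * τ ^ 2 + (24 : ℕ) * τ + (32 : ℕ))) * τ) := by
      push_cast; ring
    have hR1 : padicNorm p ((2 + ((2 : ℕ) - τ) * τ) * x - ((2 : ℕ) + τ) ^ 4) = 1 := by
      rw [hR, padicNorm_add_eq_of_lt, padicNorm.mul, n2, hx8, one_mul]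
      rw [padicNorm.mul 2, n2, hx8, one_mul]
      refine padicNorm_mul_lt_one (padicNorm_sub_le ?_ (padicNorm_add_le (padicNorm_add_le
        (padicNorm_add_le ?_ ?_) ?_) (c0 _))) ht
      · exact (padicNorm_mul_le (padicNorm_sub_le (c0 _) nτ) hx1).trans_eq (one_mul 1)
      · exact (padicNorm_pow_le nτ 3).trans_eq (one_pow 3)
      · exact (padicNorm_mul_le (c0 _) (padicNorm_pow_le nτ 2)).trans_eq (by norm_num)
      · exact (padicNorm_mul_le (c0 _) nτ).trans_eq (one_mul 1)
    rw [hR1] at hn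
    by_contra hlt
    rw [not_le] at hlt
    nlinarith
  · rw [not_le] at hx1
    have hg : padicNorm p (2 + ((2 : ℕ) - τ) * τ) = 1 := by
      rw [padicNorm_add_eq_of_lt, n2]
      rwa [n2]
    have hs : padicNorm p (((2 : ℕ) + τ) ^ 4) ≤ 1 :=
      (padicNorm_pow_le (padicNorm_add_le (c0 _) nτ) 4).trans_eq (one_pow 4)
    have hR : padicNorm p ((2 + ((2 : ℕ) - τ) * τ) * x - ((2 : ℕ) + τ) ^ 4) = padicNorm p x := by
      rw [padicNorm_sub_eq_of_lt, padicNorm.mul, hg, one_mul]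
      rw [padicNorm.mul, hg, one_mul]
      exact hs.trans_lt hx1
    rw [hR] at hn
    have : padicNorm p (curveE' t x).a₄ = 1 := by
      apply mul_right_cancel₀ nx.ne'
      rw [hn, one_mul]
    exact this.ge

/-- If an odd prime divides the numerator of `t² - 1` then `P'` has infinite order. -/
theorem nsmul_P_ne_zero_of_odd_prime (d : TripleData t x a b c A B C)
    {hP : (curveE' t x).Nonsingular 0 (a * b * c)} (hp : p ≠ 2)
    (ht : padicNorm p (t ^ 2 - 1) < 1) (hx0 : x ≠ 0) (hx : ¬ padicNorm p (x - 8) < 1)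
    {n : ℕ} (hn : n ≠ 0) :
    n • (WeierstrassCurve.Affine.Point.some 0 (a * b * c) hP) ≠ 0 := by
  have n2 := padicNorm_two_of_odd_prime hp
  have nt : padicNorm p t = 1 := by
    have h1 : padicNorm p (t ^ 2) = 1 := by
      have : t ^ 2 = 1 + (t ^ 2 - 1) := by ring
      rw [this, padicNorm_add_eq_of_lt] <;> rw [padicNorm.one]
      exact ht
    rw [padicNorm_pow] at h1
    exact (pow_eq_one_iff_of_nonneg (padicNorm.nonneg _) two_ne_zero).mp h1
  have ns : padicNorm p (t ^ 2 + 1) = 1 := by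
    have : t ^ 2 + 1 = 2 + (t ^ 2 - 1) := by ring
    rw [this, padicNorm_add_eq_of_lt] <;> rw [n2]
    exact ht
  refine d.nsmul_P_ne_zero_of_one_le (p := p) ?_ ?_ (d.one_le_padicNorm_a₄ hp ht hx0 hx) hn
  · rw [padicNorm.div, padicNorm.mul, ns, n2, nt]; norm_num
  · rw [d.abc, sigma₃, padicNorm.div, padicNorm.mul, n2, nt, one_mul, div_one]
    exact ht

end TripleData

/-! ### 2-adic congruences -/

section TwoAdic

variable {u v w : ℚ}

theorem padicNorm_two_two : padicNorm 2 (2 : ℚ) = 1 / 2 := by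
  have h : padicNorm 2 ((2 : ℕ) : ℚ) = ((2 : ℕ) : ℚ)⁻¹ := padicNorm.padicNorm_p_of_prime
  norm_num at h ⊢
  exact h

theorem padicNorm_two_sub_one_le (hw : padicNorm 2 w = 1) : padicNorm 2 (w - 1) ≤ 1 / 2 := by
  have hden : padicNorm 2 (w.den : ℚ) = 1 := by
    rw [padicNorm.nat_eq_one_iff]
    intro h
    have hnum : padicNorm 2 (w.num : ℚ) = 1 := by
      rw [padicNorm.int_eq_one_iff]
      intro h'
      have := Nat.dvd_gcd (Int.natCast_dvd.mp h') h
      rw [w.reduced] at this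
      norm_num at this
    have h2 := (padicNorm.nat_lt_one_iff (p := 2) _).mpr h
    rw [← Rat.num_div_den w, padicNorm.div, hnum] at hw
    rw [div_eq_one_iff_eq (padicNorm.nonzero (mod_cast w.den_nz))] at hw
    rw [← hw] at h2
    exact lt_irrefl _ h2
  have hnum : padicNorm 2 (w.num : ℚ) = 1 := by
    rw [← Rat.num_div_den w, padicNorm.div, hden, div_one] at hw
    exact hw
  have e : w - 1 = ((w.num - w.den : ℤ) : ℚ) / w.den := by
    have : (w.den : ℚ) ≠ 0 := mod_cast w.den_nz
    push_cast
    rw [sub_div, div_self this, Rat.num_div_den]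
  rw [e, padicNorm.div, hden, div_one]
  rw [padicNorm.nat_eq_one_iff] at hden
  rw [padicNorm.int_eq_one_iff] at hnum
  have : ((2 ^ 1 : ℕ) : ℤ) ∣ w.num - w.den := by
    push_cast at *
    omega
  have := padicNorm.dvd_iff_norm_le.mp this
  norm_num at this ⊢
  exact this

theorem padicNorm_two_add_le (hu : padicNorm 2 u = 1) (hv : padicNorm 2 v = 1) :
    padicNorm 2 (u + v) ≤ 1 / 2 := by
  have : u + v = (u - 1) + (v - 1) + 2 := by ring
  rw [this]
  exact padicNorm_add_le (padicNorm_add_le (padicNorm_two_sub_one_le hu)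
    (padicNorm_two_sub_one_le hv)) padicNorm_two_two.le

theorem padicNorm_two_le_half (hw : padicNorm 2 w < 1) : padicNorm 2 w ≤ 1 / 2 := by
  have := padicNorm_le_inv_of_lt_one hw
  norm_num at this ⊢
  exact this

theorem padicNorm_two_le_quarter (hw : padicNorm 2 w < 1 / 2) : padicNorm 2 w ≤ 1 / 4 := by
  have : padicNorm 2 (w / 2) < 1 := by
    rw [padicNorm.div, padicNorm_two_two]; linarith
  have := padicNorm_two_le_half this
  rw [padicNorm.div, padicNorm_two_two] at this
  linarith

/-- Squares of 2-adic units are 1 modulo 8: w - 1 and w + 1 are both even and one is divisible by 4.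
-/
theorem padicNorm_two_sq_sub_one_le (hw : padicNorm 2 w = 1) :
    padicNorm 2 (w ^ 2 - 1) ≤ 1 / 8 := by
  have h1 := padicNorm_two_sub_one_le hw
  have h2 : padicNorm 2 (w + 1) ≤ 1 / 2 := padicNorm_two_add_le hw padicNorm.one
  have e : w ^ 2 - 1 = (w - 1) * (w + 1) := by ring
  rw [e]
  rcases lt_or_eq_of_le h1 with h | h
  · exact (padicNorm_mul_le (padicNorm_two_le_quarter h) h2).trans_eq (by norm_num)
  · have h3 : padicNorm 2 ((w - 1) / 2) = 1 := by
      rw [padicNorm.div, h, padicNorm_two_two]; norm_num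
    have h4 := padicNorm_two_add_le h3 padicNorm.one
    have h5 : padicNorm 2 (w + 1) ≤ 1 / 4 := by
      have : w + 1 = 2 * ((w - 1) / 2 + 1) := by ring
      rw [this]
      exact (padicNorm_mul_le padicNorm_two_two.le h4).trans_eq (by norm_num)
    exact (padicNorm_mul_le h1 h5).trans_eq (by norm_num)

theorem padicNorm_two_four : padicNorm 2 (4 : ℚ) = 1 / 4 := by
  rw [show (4 : ℚ) = 2 ^ 2 by norm_num, padicNorm_pow, padicNorm_two_two]; norm_num

theorem padicNorm_two_eight : padicNorm 2 (8 : ℚ) = 1 / 8 := by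
  rw [show (8 : ℚ) = 2 ^ 3 by norm_num, padicNorm_pow, padicNorm_two_two]; norm_num

/-- Among the sum and the difference of two `2`-adic units, one is twice a unit. -/
theorem padicNorm_two_add_or_sub (hu : padicNorm 2 u = 1) (hv : padicNorm 2 v = 1) :
    padicNorm 2 (u + v) = 1 / 2 ∨ padicNorm 2 (u - v) = 1 / 2 := by
  by_contra! h
  have h1 := padicNorm_two_add_le hu hv
  have h2 : padicNorm 2 (u - v) ≤ 1 / 2 := by
    rw [sub_eq_add_neg]
    exact padicNorm_two_add_le hu (by rwa [padicNorm.neg])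
  have h3 := padicNorm_two_le_quarter (lt_of_le_of_ne h1 h.1)
  have h4 := padicNorm_two_le_quarter (lt_of_le_of_ne h2 h.2)
  have h5 := padicNorm_add_le h3 h4
  have : u + v + (u - v) = 2 * u := by ring
  rw [this, padicNorm.mul, hu, padicNorm_two_two] at h5
  norm_num at h5

end TwoAdic

/-! ### Infinite order of P': the prime 2 -/

namespace TripleData

variable {t x a b c A B C : ℚ}

/-- The situation at the prime `2` in which twice `P'` does not obviously lie near infinity. -/
structure TwoAdic (t x : ℚ) : Prop where
  q : padicNorm 2 ((t ^ 2 + 1) / (2 * t)) = 1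
  σ : padicNorm 2 (sigma₃ t) ≤ 1 / 4
  a₄ : padicNorm 2 (curveE' t x).a₄ < 1

theorem TwoAdic.half_unit (k : TwoAdic t x) :
    padicNorm 2 ((3 - (curveE' t x).a₄) / ((t ^ 2 + 1) / (2 * t))) = 1 := by
  have n3 : padicNorm 2 (3 : ℚ) = 1 := by
    exact_mod_cast (padicNorm.nat_eq_one_iff (p := 2) 3).mpr (by norm_num)
  rw [padicNorm.div, k.q, div_one, padicNorm_sub_eq_of_lt, n3]
  rw [n3]
  exact k.a₄

theorem TwoAdic.q_ne_zero (k : TwoAdic t x) : (t ^ 2 + 1) / (2 * t) ≠ 0 := by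
  intro h
  have := k.q
  rw [h] at this
  simp at this

/-- 4a₂ is the square of the unit 2e₁ minus 12, hence ≡ 1 - 12 ≡ 5 modulo 8. -/
theorem four_a₂_sub_five_le (d : TripleData t x a b c A B C) (k : TwoAdic t x) :
    padicNorm 2 (4 * (curveE' t x).a₂ - 5) ≤ 1 / 8 := by
  have h := padicNorm_two_sq_sub_one_le k.half_unit
  have : 4 * (curveE' t x).a₂ - 5 =
      (((3 - (curveE' t x).a₄) / ((t ^ 2 + 1) / (2 * t))) ^ 2 - 1) - 8 * 2 := by
    rw [d.four_mul_a₂ k.q_ne_zero]; ring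
  rw [this]
  refine padicNorm_sub_le h ?_
  rw [padicNorm.mul, padicNorm_two_two, padicNorm_two_eight]
  norm_num

theorem four_a₂_eq_one (d : TripleData t x a b c A B C) (k : TwoAdic t x) :
    padicNorm 2 (4 * (curveE' t x).a₂) = 1 := by
  have n5 : padicNorm 2 (5 : ℚ) = 1 := by
    exact_mod_cast (padicNorm.nat_eq_one_iff (p := 2) 5).mpr (by norm_num)
  have : 4 * (curveE' t x).a₂ = 5 + (4 * (curveE' t x).a₂ - 5) := by ring
  rw [this, padicNorm_add_eq_of_lt, n5]
  rw [n5]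
  exact (d.four_a₂_sub_five_le k).trans_lt (by norm_num)

theorem integralScaled_two (d : TripleData t x a b c A B C) (k : TwoAdic t x) :
    IntegralScaled 2 2 (curveE' t x) := by
  have c0 : ∀ k : ℕ, padicNorm 2 (k : ℚ) ≤ 1 := fun k => padicNorm.of_nat k
  refine ⟨two_ne_zero, ?_, ?_, ?_⟩
  · rw [show (2 : ℚ) ^ 2 = 4 by norm_num]
    exact (d.four_a₂_eq_one k).le
  · rw [show (2 : ℚ) ^ 4 = (16 : ℕ) by norm_num]
    exact (padicNorm_mul_le (c0 _) k.a₄.le).trans (by norm_num)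
  · rw [show (2 : ℚ) ^ 6 = (64 : ℕ) by norm_num, d.a₆_eq, d.abc]
    exact (padicNorm_mul_le (c0 _) (padicNorm_pow_le k.σ 2)).trans (by norm_num)

/-- The points near infinity have infinite order, unless they are of order two. -/
theorem nsmul_ne_zero_of_four_le (d : TripleData t x a b c A B C) (k : TwoAdic t x)
    (ha₄ : padicNorm 2 (curveE' t x).a₄ ≤ padicNorm 2 (sigma₃ t)) {X Y : ℚ}
    (h : (curveE' t x).Nonsingular X Y) (hX : 4 ≤ padicNorm 2 X) (hY : Y ≠ 0) {n : ℕ}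
    (hn : n ≠ 0) : n • (WeierstrassCurve.Affine.Point.some X Y h) ≠ 0 := by
  have hW := isShort_curveE' t x
  have hint := d.integralScaled_two k
  rcases hX.lt_or_eq with hX | hX
  · refine nsmul_ne_zero_of_not_integral hW hint h ?_ hn
    rw [show (2 : ℚ) ^ 2 = 4 by norm_num, padicNorm.mul, padicNorm_two_four]
    linarith
  · obtain ⟨L, M, X', Y', h', e, e₁, -, hl, -⟩ := hW.exists_double h hY
    have c0 : ∀ k : ℕ, padicNorm 2 (k : ℚ) ≤ 1 := fun k => padicNorm.of_nat k
    have heq := (hW.equation_iff _ _).mp h.1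
    have hn2 := d.four_a₂_eq_one k
    have hn4 := ha₄.trans k.σ
    have hn6 : padicNorm 2 (curveE' t x).a₆ ≤ 1 / 16 := by
      rw [d.a₆_eq, d.abc]
      exact (padicNorm_pow_le k.σ 2).trans_eq (by norm_num)
    have hdbl : X' * (4 * Y ^ 2) = X ^ 4 + ((curveE' t x).a₄ ^ 2 -
        (2 : ℕ) * ((curveE' t x).a₄ * X ^ 2) - (8 : ℕ) * ((curveE' t x).a₆ * X) -
        4 * (curveE' t x).a₂ * (curveE' t x).a₆) := by
      push_cast
      rw [hl.a₂_eq, hl.a₄_eq, hl.a₆_eq, e₁]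
      ring
    have hnum : padicNorm 2 (X' * (4 * Y ^ 2)) = 256 := by
      have h4 : padicNorm 2 (X ^ 4) = 256 := by rw [padicNorm_pow, ← hX]; norm_num
      rw [hdbl, padicNorm_add_eq_of_lt, h4]
      rw [h4]
      refine lt_of_le_of_lt (b := 4) (padicNorm_sub_le (padicNorm_sub_le (padicNorm_sub_le
        ((padicNorm_pow_le hn4 2).trans ?_)
        ((padicNorm_mul_le (c0 2) (padicNorm_mul_le hn4 (padicNorm_pow_le hX.ge 2))).trans ?_))
        ((padicNorm_mul_le (c0 8) (padicNorm_mul_le hn6 hX.ge)).trans ?_))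
        ((padicNorm_mul_le hn2.le hn6).trans ?_)) ?_ <;> norm_num
    have hden : padicNorm 2 (4 * Y ^ 2) ≤ 8 := by
      have h4X : padicNorm 2 (4 * X) = 1 := by
        rw [padicNorm.mul, padicNorm_two_four, ← hX]; norm_num
      have : (4 : ℚ) ^ 2 * (4 * Y ^ 2) = (4 * X) ^ 3 + 4 * (curveE' t x).a₂ * (4 * X) ^ 2 +
          (8 * 2 * ((curveE' t x).a₄ * (4 * X)) + 8 * 8 * (curveE' t x).a₆) := by
        rw [heq]; ring
      -- A sum of two units is even. This gain makes 4Y² small enough for [2](X, Y) to enter the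
      -- formal group, although |X| = 4 is only on its border.
      have h1 : padicNorm 2 ((4 * X) ^ 3 + 4 * (curveE' t x).a₂ * (4 * X) ^ 2) ≤ 1 / 2 :=
        padicNorm_two_add_le (by rw [padicNorm_pow, h4X, one_pow])
          (by rw [padicNorm.mul, hn2, padicNorm_pow, h4X, one_pow, one_mul])
      have h2 := congrArg (padicNorm 2) this
      have n16 : padicNorm 2 ((4 : ℚ) ^ 2) = 1 / 16 := by
        rw [padicNorm_pow, padicNorm_two_four]; norm_num
      rw [padicNorm.mul, n16] at h2
      have n8 := padicNorm_two_eight.le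
      have h3 := padicNorm_add_le h1 (padicNorm_add_le
        ((padicNorm_mul_le (padicNorm_mul_le n8 padicNorm_two_two.le)
          (padicNorm_mul_le hn4 h4X.le)).trans (by norm_num))
        ((padicNorm_mul_le (padicNorm_mul_le n8 n8) hn6).trans (by norm_num)))
      linarith
    have hX' : 1 < padicNorm 2 (2 ^ 2 * X') := by
      rw [show (2 : ℚ) ^ 2 = 4 by norm_num, padicNorm.mul, padicNorm_two_four]
      rw [padicNorm.mul] at hnum
      nlinarith [padicNorm.nonneg (p := 2) X', padicNorm.nonneg (p := 2) (4 * Y ^ 2)]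
    intro hz
    apply nsmul_ne_zero_of_not_integral hW hint h' hX' hn
    rw [← e, smul_comm, hz, nsmul_zero]

end TripleData

namespace TripleData

variable {t x a b c A B C ρ : ℚ}

/-- The data are symmetric in a, b, c; statements about one root of E' transfer to the others by
this rotation. -/
theorem rotate (d : TripleData t x a b c A B C) : TripleData t x b c a C A B where
  t_ne := d.t_ne
  ab := d.bc
  ac := by rw [mul_comm]; exact d.ab
  bc := by rw [mul_comm]; exact d.ac
  abc := by rw [← d.abc]; ring
  abc_ne := by
    have := d.abc_ne
    rwa [show b * c * a = a * b * c by ring]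
  flex := by linear_combination d.flex
  sum_add_prod := by rw [← d.sum_add_prod]; ring
  A_ne := d.C_ne
  B_ne := d.A_ne
  C_ne := d.B_ne
  AB := d.AC.symm
  AC := d.BC.symm
  BC := d.AB
  sigma₁_eq := by rw [d.sigma₁_eq]; ring
  sigma₂_eq := by rw [d.sigma₂_eq]; ring

theorem swap (d : TripleData t x a b c A B C) : TripleData t x b a c A C B where
  t_ne := d.t_ne
  ab := by rw [mul_comm]; exact d.ab
  ac := d.bc
  bc := d.ac
  abc := by rw [← d.abc]; ring
  abc_ne := by
    have := d.abc_ne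
    rwa [show b * a * c = a * b * c by ring]
  flex := by linear_combination d.flex
  sum_add_prod := by rw [← d.sum_add_prod]; ring
  A_ne := d.A_ne
  B_ne := d.C_ne
  C_ne := d.B_ne
  AB := d.AC
  AC := d.AB
  BC := d.BC.symm
  sigma₁_eq := by rw [d.sigma₁_eq]; ring
  sigma₂_eq := by rw [d.sigma₂_eq]; ring

theorem two_mul_sum_eq (d : TripleData t x a b c A B C) (k : TwoAdic t x) :
    2 * (A + B + C) = (3 - (curveE' t x).a₄) / ((t ^ 2 + 1) / (2 * t)) := by
  rw [eq_div_iff k.q_ne_zero, d.a₄_eq, d.sum_add_prod]; ring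

theorem padicNorm_two_mul_prod (d : TripleData t x a b c A B C) (k : TwoAdic t x) :
    padicNorm 2 (2 * (A * B * C)) = 1 := by
  have h1 : padicNorm 2 (2 * (A + B + C)) = 1 := by rw [d.two_mul_sum_eq k, k.half_unit]
  have h2 : padicNorm 2 (2 * ((t ^ 2 + 1) / (2 * t))) = 1 / 2 := by
    rw [padicNorm.mul, k.q, padicNorm_two_two, mul_one]
  have : 2 * (A * B * C) = -(2 * (A + B + C) - 2 * ((t ^ 2 + 1) / (2 * t))) := by
    rw [← d.sum_add_prod]; ring
  rw [this, padicNorm.neg, padicNorm_sub_eq_of_lt, h1]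
  rw [h1, h2]; norm_num

theorem padicNorm_prod (d : TripleData t x a b c A B C) (k : TwoAdic t x) :
    padicNorm 2 A * padicNorm 2 B * padicNorm 2 C = 2 := by
  have := d.padicNorm_two_mul_prod k
  rw [padicNorm.mul, padicNorm.mul, padicNorm.mul, padicNorm_two_two] at this
  linarith

/-- A is a root of 2Z³ - 2e₁Z² - 2e₃ with 2e₁ and 2e₃ units, so its Newton polygon allows only the
norms 1 and 2. As |ABC| = 2, exactly one of A, B, C has norm 2. -/
theorem padicNorm_A (d : TripleData t x a b c A B C) (k : TwoAdic t x) :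
    padicNorm 2 A = 1 ∨ padicNorm 2 A = 2 := by
  have h1 : padicNorm 2 (2 * (A + B + C)) = 1 := by rw [d.two_mul_sum_eq k, k.half_unit]
  have h3 := d.padicNorm_two_mul_prod k
  have hA := padicNorm_pos (p := 2) d.A_ne
  have e : 2 * A ^ 3 = 2 * (A * B * C) + 2 * (A + B + C) * A ^ 2 := by
    linear_combination (-2) * A * d.flex
  have e' := congrArg (padicNorm 2) e
  rw [padicNorm.mul, padicNorm_two_two, padicNorm_pow] at e'
  have hlow : 1 ≤ padicNorm 2 A := by
    by_contra! hlt
    have hsq : padicNorm 2 (2 * (A + B + C) * A ^ 2) < 1 := by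
      rw [padicNorm.mul, h1, padicNorm_pow, one_mul]
      exact pow_lt_one₀ hA.le hlt two_ne_zero
    rw [padicNorm_add_eq_of_lt (by rwa [h3]), h3] at e'
    have := pow_lt_one₀ hA.le hlt three_ne_zero
    linarith
  have hup : padicNorm 2 A < 4 := by
    have : padicNorm 2 (2 * (A * B * C) + 2 * (A + B + C) * A ^ 2) ≤ padicNorm 2 A ^ 2 := by
      refine padicNorm_add_le ?_ ?_
      · rw [h3]; exact one_le_pow₀ hlow
      · rw [padicNorm.mul, h1, padicNorm_pow, one_mul]
    rw [← e'] at this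
    by_contra! hge
    have h0 : 0 < padicNorm 2 A ^ 2 := by positivity
    nlinarith
  have hup' : padicNorm 2 A ≤ 2 := by
    have : padicNorm 2 (4 * A) < 1 := by rw [padicNorm.mul, padicNorm_two_four]; linarith
    have := padicNorm_two_le_half this
    rw [padicNorm.mul, padicNorm_two_four] at this
    linarith
  rcases hup'.lt_or_eq with h | h
  · left
    have : padicNorm 2 (2 * A) < 1 := by rw [padicNorm.mul, padicNorm_two_two]; linarith
    have := padicNorm_two_le_half this
    rw [padicNorm.mul, padicNorm_two_two] at this
    linarith
  · exact Or.inr h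

/-- A `2`-torsion point near infinity is not twice a point. -/
theorem X_ne_of_double (d : TripleData t x a b c A B C) (k : TwoAdic t x)
    {Q : (curveE' t x).Point} {X Y : ℚ} {h : (curveE' t x).Nonsingular X Y}
    (hQ : 2 • Q = .some X Y h) (hX : 4 ≤ padicNorm 2 X) : X ≠ -(a * b) := by
  intro hXe
  have hXA : X = 1 - A ^ 2 := by rw [hXe, ← d.ab]; ring
  have hA2 : padicNorm 2 A = 2 := by
    refine (d.padicNorm_A k).resolve_left fun h1 => ?_
    have : padicNorm 2 X ≤ 1 := by
      rw [hXA]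
      exact padicNorm_sub_le padicNorm.one.le (by rw [padicNorm_pow, h1, one_pow])
    linarith
  have hBC := d.padicNorm_prod k
  have hB1 : padicNorm 2 B = 1 := by
    have hC1 : 1 ≤ padicNorm 2 C := by rcases d.rotate.padicNorm_A k with h | h <;> linarith
    refine (d.rotate.rotate.padicNorm_A k).resolve_right fun hB2 => ?_
    rw [hA2, hB2] at hBC
    linarith
  obtain ⟨r, hr⟩ := d.hasRoots.rotate.exists_sq_of_double hQ
  have hr' : r ^ 2 = B ^ 2 - A ^ 2 := by
    rw [← hr, hXA, ← d.ac]; ring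
  have nA : padicNorm 2 (A ^ 2) = 4 := by rw [padicNorm_pow, hA2]; norm_num
  have nB : padicNorm 2 (B ^ 2) = 1 := by rw [padicNorm_pow, hB1]; norm_num
  have nr : padicNorm 2 r ^ 2 = 4 := by
    rw [← padicNorm_pow, hr', ← neg_sub, padicNorm.neg, padicNorm_sub_eq_of_lt, nA]
    rw [nA, nB]; norm_num
  have nr2 : padicNorm 2 r = 2 := by
    nlinarith [padicNorm.nonneg (p := 2) r]
  have u1 : padicNorm 2 ((2 * r) ^ 2 - 1) ≤ 1 / 8 :=
    padicNorm_two_sq_sub_one_le (by rw [padicNorm.mul, nr2, padicNorm_two_two]; norm_num)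
  have u2 : padicNorm 2 ((2 * A) ^ 2 - 1) ≤ 1 / 8 :=
    padicNorm_two_sq_sub_one_le (by rw [padicNorm.mul, hA2, padicNorm_two_two]; norm_num)
  -- (2r)² + (2A)² = 4B² is impossible: the left side is a sum of two odd squares, ≡ 2 modulo 8, and
  -- the right side is divisible by 4.
  have e : 2 - 4 * B ^ 2 = -(((2 * r) ^ 2 - 1) + ((2 * A) ^ 2 - 1)) := by
    linear_combination 4 * hr'
  have n := padicNorm_add_le u1 u2
  rw [← padicNorm.neg, ← e, padicNorm_sub_eq_of_lt, padicNorm_two_two] at n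
  · norm_num at n
  · rw [padicNorm.mul, nB, padicNorm_two_two, padicNorm_two_four]; norm_num

theorem nsmul_ne_zero_of_double (d : TripleData t x a b c A B C) (k : TwoAdic t x)
    (ha₄ : padicNorm 2 (curveE' t x).a₄ ≤ padicNorm 2 (sigma₃ t))
    {Q : (curveE' t x).Point} {X Y : ℚ} {h : (curveE' t x).Nonsingular X Y}
    (hQ : 2 • Q = .some X Y h) (hX : 4 ≤ padicNorm 2 X) {n : ℕ} (hn : n ≠ 0) : n • Q ≠ 0 := by
  have hY : Y ≠ 0 := by
    intro hY
    rcases d.hasRoots.two_nsmul_eq_zero h hY with e | e | e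
    · exact d.X_ne_of_double k hQ hX e
    · exact d.rotate.rotate.X_ne_of_double k hQ hX (by rw [e]; ring)
    · exact d.rotate.X_ne_of_double k hQ hX e
  intro hz
  apply d.nsmul_ne_zero_of_four_le k ha₄ h hX hY hn
  rw [← hQ, smul_comm, hz, nsmul_zero]

/-- If `|a₄| ≠ |σ₃|` then twice `P'` lies near infinity. -/
theorem nsmul_P_ne_zero_of_ne (d : TripleData t x a b c A B C) (k : TwoAdic t x)
    {hP : (curveE' t x).Nonsingular 0 (a * b * c)}
    (hne : padicNorm 2 (curveE' t x).a₄ ≠ padicNorm 2 (sigma₃ t)) {n : ℕ} (hn : n ≠ 0) :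
    n • (WeierstrassCurve.Affine.Point.some 0 (a * b * c) hP) ≠ 0 := by
  obtain ⟨X, Y, h, e, hX⟩ := d.exists_double_P hP
  have h0 := d.abc_ne
  have hX' : 4 * X = ((curveE' t x).a₄ / (a * b * c)) ^ 2 - 4 * (curveE' t x).a₂ := by
    rw [hX]; field_simp
  have n2 := d.four_a₂_eq_one k
  have hpos := padicNorm_pos (p := 2) h0
  have hn4 := congrArg (padicNorm 2) hX'
  rw [padicNorm.mul, padicNorm_two_four] at hn4
  rw [← d.abc] at hne
  -- 4x([2]P') = (a₄/σ₃)² - 4a₂ with 4a₂ a unit: if |a₄| < |σ₃| then |x([2]P')| = 4, the border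
  -- case; if |a₄| > |σ₃| then [2]P' is already in the formal group.
  rcases hne.lt_or_gt with hlt | hlt
  · have : padicNorm 2 (((curveE' t x).a₄ / (a * b * c)) ^ 2) < 1 := by
      rw [padicNorm_pow]
      refine pow_lt_one₀ (padicNorm.nonneg _) ?_ two_ne_zero
      rwa [padicNorm.div, div_lt_one hpos]
    rw [← neg_sub, padicNorm.neg, padicNorm_sub_eq_of_lt (by rwa [n2]), n2] at hn4
    exact d.nsmul_ne_zero_of_double k (by rw [← d.abc]; exact hlt.le) e (by linarith) hn
  · have : 1 < padicNorm 2 (((curveE' t x).a₄ / (a * b * c)) ^ 2) := by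
      rw [padicNorm_pow, padicNorm.div]
      exact one_lt_pow₀ ((one_lt_div hpos).mpr hlt) two_ne_zero
    rw [padicNorm_sub_eq_of_lt (by rwa [n2])] at hn4
    intro hz
    refine nsmul_ne_zero_of_not_integral (isShort_curveE' t x) (d.integralScaled_two k) h ?_ hn ?_
    · rw [show (2 : ℚ) ^ 2 = 4 by norm_num, padicNorm.mul, padicNorm_two_four]
      linarith
    · rw [← e, smul_comm, hz, nsmul_zero]

end TripleData

/-! ### When P' + S' has order two -/

section Parametrization

/-- The numerator of `4C² - 1` has an odd prime factor when `C` is a `2`-adic unit. -/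
theorem exists_odd_prime_of_padicNorm_two {C : ℚ} (hC : padicNorm 2 C = 1) :
    ∃ p, ∃ _ : Fact p.Prime, p ≠ 2 ∧ padicNorm p (4 * C ^ 2 - 1) < 1 := by
  have hden : ¬ 2 ∣ C.den := by
    intro h
    have hnum : padicNorm 2 (C.num : ℚ) = 1 := by
      rw [padicNorm.int_eq_one_iff]
      intro h'
      have := Nat.dvd_gcd (Int.natCast_dvd.mp h') h
      rw [C.reduced] at this
      norm_num at this
    have h2 := (padicNorm.nat_lt_one_iff (p := 2) _).mpr h
    rw [← Rat.num_div_den C, padicNorm.div, hnum] at hC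
    rw [div_eq_one_iff_eq (padicNorm.nonzero (mod_cast C.den_nz))] at hC
    rw [← hC] at h2
    exact lt_irrefl _ h2
  have hnum0 : C.num ≠ 0 := by
    intro h
    rw [Rat.num_eq_zero] at h
    rw [h] at hC
    simp at hC
  obtain ⟨e, he⟩ : ∃ e : ℤ, e = (C.den : ℤ) := ⟨_, rfl⟩
  obtain ⟨z, hz⟩ : ∃ z : ℤ, z = C.num := ⟨_, rfl⟩
  have hodd : ¬ (2 : ℤ) ∣ e := by omega
  -- If both factors were ±1, their sum 4z would force z = 0.
  have hk : ((2 * z - e) * (2 * z + e)).natAbs ≠ 1 := by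
    intro h
    rw [Int.natAbs_mul, mul_eq_one] at h
    omega
  obtain ⟨p, hp, hpk⟩ := Nat.exists_prime_and_dvd hk
  have hfact := Fact.mk hp
  have hpk' : (p : ℤ) ∣ (2 * z - e) * (2 * z + e) := Int.natCast_dvd.mpr hpk
  have hpZ : Prime (p : ℤ) := Nat.prime_iff_prime_int.mp hp
  have hp2 : p ≠ 2 := by
    rintro rfl
    rcases hpZ.dvd_or_dvd hpk' with h | h <;> push_cast at h <;> omega
  have hpe : ¬ p ∣ C.den := by
    intro h
    have h1 : (p : ℤ) ∣ e := by rw [he]; exact_mod_cast h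
    have h2 : (p : ℤ) ∣ 2 * z := by
      rcases hpZ.dvd_or_dvd hpk' with h | h
      · exact (dvd_sub_left h1).mp h
      · exact (dvd_add_left h1).mp h
    rcases hpZ.dvd_or_dvd h2 with h3 | h3
    · have : p ∣ 2 := by exact_mod_cast h3
      exact hp2 ((Nat.prime_dvd_prime_iff_eq hp Nat.prime_two).mp this)
    · rw [hz] at h3
      have := Nat.dvd_gcd (Int.natCast_dvd.mp h3) h
      rw [C.reduced] at this
      exact hp.one_lt.ne' (Nat.dvd_one.mp this)
  refine ⟨p, hfact, hp2, ?_⟩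
  have : 4 * C ^ 2 - 1 = (((2 * z - e) * (2 * z + e) : ℤ) : ℚ) / (C.den : ℚ) ^ 2 := by
    have h0 : (C.den : ℚ) ≠ 0 := mod_cast C.den_nz
    have hCz : C * C.den = z := by rw [hz]; exact Rat.mul_den_eq_num C
    rw [eq_div_iff (pow_ne_zero 2 h0), he]
    push_cast
    rw [← hCz]; ring
  rw [this, padicNorm.div, padicNorm_pow, (padicNorm.nat_eq_one_iff (p := p) _).mpr hpe, one_pow,
    div_one]
  exact padicNorm.int_lt_one_iff _ |>.mpr hpk'

/-- For t = C/(2C²-1) the numerator of t² - 1 is (1 - C²)(4C² - 1); the inverse value of t only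
changes its sign. -/
theorem padicNorm_sq_sub_one_lt {p : ℕ} [Fact p.Prime] (hp : p ≠ 2) {C t : ℚ}
    (hC : padicNorm p (4 * C ^ 2 - 1) < 1)
    (h : t * (2 * C ^ 2 - 1) = C ∨ t * C = 2 * C ^ 2 - 1) : padicNorm p (t ^ 2 - 1) < 1 := by
  have n2 := padicNorm_two_of_odd_prime hp
  have nC : padicNorm p C = 1 := by
    have h1 : padicNorm p ((2 * C) ^ 2) = 1 := by
      have : (2 * C) ^ 2 = 1 + (4 * C ^ 2 - 1) := by ring
      rw [this, padicNorm_add_eq_of_lt] <;> rw [padicNorm.one]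
      exact hC
    rw [padicNorm_pow, padicNorm.mul, n2, one_mul] at h1
    exact (pow_eq_one_iff_of_nonneg (padicNorm.nonneg _) two_ne_zero).mp h1
  have nD : padicNorm p (2 * C ^ 2 - 1) = 1 := by
    have h1 : padicNorm p (2 * (2 * C ^ 2 - 1)) = 1 := by
      have : 2 * (2 * C ^ 2 - 1) = -(1 - (4 * C ^ 2 - 1)) := by ring
      rw [this, padicNorm.neg, padicNorm_sub_eq_of_lt] <;> rw [padicNorm.one]
      exact hC
    rwa [padicNorm.mul, n2, one_mul] at h1
  have nE : padicNorm p ((1 - C ^ 2) * (4 * C ^ 2 - 1)) < 1 := by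
    refine padicNorm_mul_lt_one (padicNorm_sub_le padicNorm.one.le ?_) hC
    rw [padicNorm_pow, nC, one_pow]
  rcases h with h | h
  · have e : (t ^ 2 - 1) * (2 * C ^ 2 - 1) ^ 2 = (1 - C ^ 2) * (4 * C ^ 2 - 1) := by
      linear_combination (t * (2 * C ^ 2 - 1) + C) * h
    rw [← e, padicNorm.mul, padicNorm_pow, nD, one_pow, mul_one] at nE
    exact nE
  · have e : (t ^ 2 - 1) * C ^ 2 = -((1 - C ^ 2) * (4 * C ^ 2 - 1)) := by
      linear_combination (t * C + (2 * C ^ 2 - 1)) * h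
    rw [← padicNorm.neg, ← e, padicNorm.mul, padicNorm_pow, nC, one_pow, mul_one] at nE
    exact nE

end Parametrization

namespace TripleData

variable {t x a b c A B C ρ : ℚ}

/-- The hypothesis says that the line through P' and (1, ρ) vanishes at the root X = 1 - A² of E'.
Squaring ρ(1 - A²) = -abc·A² removes the sign of ρ, and e₂ = 0 reduces the result to 2BC = -1. -/
theorem two_mul_eq_neg_one (d : TripleData t x a b c A B C) (hρ : ρ ^ 2 = (A * B * C) ^ 2)
    (h : (ρ - a * b * c) * (1 - A ^ 2) + a * b * c = 0) : 2 * (B * C) = -1 := by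
  have hσ : (a * b * c) ^ 2 = (A ^ 2 - 1) * (B ^ 2 - 1) * (C ^ 2 - 1) := by
    rw [← d.ab, ← d.ac, ← d.bc]; ring
  have hA1 : A ^ 2 - 1 ≠ 0 := by
    intro h1
    rw [← d.ab] at h1
    apply d.abc_ne
    linear_combination c * h1
  have hA := pow_ne_zero 2 d.A_ne
  have h1 : (A ^ 2 - 1) * A ^ 2 * (B ^ 2 * C ^ 2 * (A ^ 2 - 1)) =
      (A ^ 2 - 1) * A ^ 2 * (A ^ 2 * (B ^ 2 - 1) * (C ^ 2 - 1)) := by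
    linear_combination (ρ * (1 - A ^ 2) - a * b * c * A ^ 2) * h - (A ^ 2 - 1) ^ 2 * hρ + A ^ 4 * hσ
  have h2 := mul_left_cancel₀ (mul_ne_zero hA1 hA) h1
  apply mul_left_cancel₀ hA
  linear_combination (-1) * h2 + (A * B + A * C - B * C) * d.flex

/-- If 2BC = -1 then e₂ = 0 gives A = C/(2C²-1), and e₁ + e₃ = (A + 1/A)/2. Comparison with s/(2t) =
(t + 1/t)/2 yields t = A or t = 1/A. Since |BC| = 2, one of B, C is a unit, and it may be taken to
be C. -/
theorem exists_odd_prime_of_two_mul_eq (d : TripleData t x a b c A B C) (k : TwoAdic t x)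
    (h : 2 * (B * C) = -1) :
    ∃ p, ∃ _ : Fact p.Prime, p ≠ 2 ∧ padicNorm p (t ^ 2 - 1) < 1 := by
  wlog hC : padicNorm 2 C = 1 generalizing a b A B C
  · refine this d.swap (by linear_combination h) ?_
    have hC2 := (d.rotate.padicNorm_A k).resolve_left hC
    refine (d.rotate.rotate.padicNorm_A k).resolve_right fun hB2 => ?_
    have := congrArg (padicNorm 2) h
    rw [padicNorm.mul, padicNorm.mul, hC2, hB2, padicNorm_two_two, padicNorm.neg,
      padicNorm.one] at this
    norm_num at this
  obtain ⟨p, hp, hp2, hlt⟩ := exists_odd_prime_of_padicNorm_two hC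
  refine ⟨p, hp, hp2, padicNorm_sq_sub_one_lt hp2 hlt ?_⟩
  have hA : A * (2 * C ^ 2 - 1) = C := by
    linear_combination (2 * C) * d.flex - (A + C) * h
  have hq : (A + B + C + A * B * C) * (2 * t) = t ^ 2 + 1 := by
    rw [d.sum_add_prod, div_mul_cancel₀]
    exact mul_ne_zero two_ne_zero d.t_ne
  have : (t * (2 * C ^ 2 - 1) - C) * (t * C - (2 * C ^ 2 - 1)) = 0 := by
    linear_combination (-C * (2 * C ^ 2 - 1)) * hq + t * (2 * C + 2 * B * C ^ 2) * hA +
      t * (2 * C ^ 2 - 1 + C ^ 2) * h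
  rcases mul_eq_zero.mp this with h | h
  · exact Or.inl (sub_eq_zero.mp h)
  · exact Or.inr (sub_eq_zero.mp h)

theorem add_Y_ne_zero (d : TripleData t x a b c A B C) (k : TwoAdic t x)
    (hno : ¬ ∃ p, ∃ _ : Fact p.Prime, p ≠ 2 ∧ padicNorm p (t ^ 2 - 1) < 1)
    (hρ : ρ ^ 2 = (A * B * C) ^ 2) {X : ℚ} {h : (curveE' t x).Nonsingular X 0}
    (hX : (ρ - a * b * c) * X + a * b * c = 0) : False := by
  apply hno
  rcases d.hasRoots.two_nsmul_eq_zero h rfl with e | e | e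
  · refine d.exists_odd_prime_of_two_mul_eq k (d.two_mul_eq_neg_one hρ ?_)
    rw [← hX, e, ← d.ab]; ring
  · have d' := d.rotate.rotate
    refine d'.exists_odd_prime_of_two_mul_eq k (d'.two_mul_eq_neg_one (ρ := ρ) (by rw [hρ]; ring) ?_)
    rw [← hX, e, ← d.ac]; ring
  · have d' := d.rotate
    refine d'.exists_odd_prime_of_two_mul_eq k (d'.two_mul_eq_neg_one (ρ := ρ) (by rw [hρ]; ring) ?_)
    rw [← hX, e, ← d.bc]; ring

end TripleData

/-- The `2`-adic size of the `X`-coordinate of the double of a point with `X = σz`, on the curve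
`Y² = X³ + αX² + σθX + σ²`. -/
theorem four_le_padicNorm_double {σ θ z α w v : ℚ} (hα : padicNorm 2 (4 * α - 5) ≤ 1 / 8)
    (hσ0 : σ ≠ 0) (nσ : padicNorm 2 σ ≤ 1 / 4) (nθ : padicNorm 2 θ = 1)
    (nz : padicNorm 2 z = 1 / 2)
    (hw : w = σ ^ 2 * (σ * z ^ 3 + α * z ^ 2 + θ * z + 1))
    (hv : v * (4 * w) = σ ^ 2 * (σ ^ 2 * z ^ 4 - 2 * θ * σ * z ^ 2 - 8 * σ * z + θ ^ 2 - 4 * α)) :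
    4 ≤ padicNorm 2 v := by
  obtain ⟨o, ho⟩ : ∃ o, z = 2 * o := ⟨z / 2, by ring⟩
  have no : padicNorm 2 o = 1 := by
    rw [ho, padicNorm.mul, padicNorm_two_two] at nz
    linarith
  have n2 := padicNorm_two_two.le
  have n8 := padicNorm_two_eight.le
  have hσpos := padicNorm_pos (p := 2) hσ0
  have hnum : padicNorm 2 (v * (4 * w)) = padicNorm 2 σ ^ 2 * (1 / 4) := by
    have : v * (4 * w) = -(σ ^ 2 * (4 - (θ ^ 2 - 1 - (4 * α - 5) +
        (σ ^ 2 * z ^ 4 - 2 * θ * σ * z ^ 2 - 8 * σ * z)))) := by rw [hv]; ring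
    rw [this, padicNorm.neg, padicNorm.mul, padicNorm_pow, padicNorm_sub_eq_of_lt,
      padicNorm_two_four]
    rw [padicNorm_two_four]
    refine lt_of_le_of_lt (b := 1 / 8) (padicNorm_add_le (padicNorm_sub_le
      (padicNorm_two_sq_sub_one_le nθ) hα) (padicNorm_sub_le (padicNorm_sub_le
      ((padicNorm_mul_le (padicNorm_pow_le nσ 2) (padicNorm_pow_le nz.le 4)).trans ?_)
      ((padicNorm_mul_le (padicNorm_mul_le (padicNorm_mul_le n2 nθ.le) nσ)
        (padicNorm_pow_le nz.le 2)).trans ?_))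
      ((padicNorm_mul_le (padicNorm_mul_le n8 nσ) nz.le).trans ?_))) ?_ <;> norm_num
  have hden : padicNorm 2 (4 * w) ≤ padicNorm 2 σ ^ 2 * (1 / 16) := by
    -- With z = 2o, 4αo² + 2θo + 1 ≡ 5 + 2 + 1 ≡ 0 modulo 4. Above, θ² - 4α ≡ 1 - 5 modulo 8 has
    -- norm exactly 1/4.
    have h1 : padicNorm 2 (σ * z ^ 3 + ((4 * α - 5) * o ^ 2 +
        (5 : ℕ) * (o ^ 2 - 1) + 2 * (θ * o - 1) + 8)) ≤ 1 / 4 := by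
      refine padicNorm_add_le ((padicNorm_mul_le nσ (padicNorm_pow_le nz.le 3)).trans ?_)
        (padicNorm_add_le (padicNorm_add_le (padicNorm_add_le
        ((padicNorm_mul_le hα (padicNorm_pow_le no.le 2)).trans ?_)
        ((padicNorm_mul_le (padicNorm.of_nat 5) (padicNorm_two_sq_sub_one_le no)).trans ?_))
        ((padicNorm_mul_le n2 (padicNorm_two_sub_one_le ?_)).trans ?_)) (n8.trans ?_))
      · norm_num
      · norm_num
      · norm_num
      · rw [padicNorm.mul, nθ, no, one_mul]
      · norm_num
      · norm_num
    have h2 : 4 * w = 4 * σ ^ 2 * (σ * z ^ 3 + ((4 * α - 5) * o ^ 2 +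
        (5 : ℕ) * (o ^ 2 - 1) + 2 * (θ * o - 1) + 8)) := by
      rw [hw, ho]; push_cast; ring
    rw [h2]
    refine (padicNorm_mul_le (padicNorm_mul_le padicNorm_two_four.le
      (padicNorm_pow_le le_rfl 2)) h1).trans_eq ?_
    ring
  rw [padicNorm.mul] at hnum
  by_contra! hlt
  have h1 := mul_le_mul_of_nonneg_left hden (padicNorm.nonneg (p := 2) v)
  have h2 := mul_lt_mul_of_pos_right hlt (pow_pos hσpos 2)
  linarith

namespace TripleData

variable {t x a b c A B C ρ : ℚ}

/-- If `|a₄| = |σ₃|` and `S` is a suitable point of order three over `X = 1`, then twice `P' + S`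
lies near infinity. -/
theorem nsmul_P_ne_zero_of_eq_aux (d : TripleData t x a b c A B C) (k : TwoAdic t x)
    (hno : ¬ ∃ p, ∃ _ : Fact p.Prime, p ≠ 2 ∧ padicNorm p (t ^ 2 - 1) < 1)
    {hP : (curveE' t x).Nonsingular 0 (a * b * c)} {hS : (curveE' t x).Nonsingular 1 ρ}
    (h3 : 3 • (WeierstrassCurve.Affine.Point.some 1 ρ hS) = 0) (hρ : ρ ^ 2 = (A * B * C) ^ 2)
    (hθ : padicNorm 2 (curveE' t x).a₄ = padicNorm 2 (sigma₃ t))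
    (hsign : padicNorm 2 ((curveE' t x).a₄ / (a * b * c) - 2 * ρ) = 1 / 2) {n : ℕ} (hn : n ≠ 0) :
    n • (WeierstrassCurve.Affine.Point.some 0 (a * b * c) hP) ≠ 0 := by
  have hW := isShort_curveE' t x
  have h0 := d.abc_ne
  obtain ⟨L, M, X, Y, hQ, e, e₁, e₂, e₃, hl, -⟩ := hW.exists_line hP hS (by simp)
  have ha₆ := d.a₆_eq
  have nσ := k.σ
  rw [← d.abc] at nσ hθ
  obtain ⟨σ, hσ⟩ : ∃ σ, σ = a * b * c := ⟨_, rfl⟩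
  obtain ⟨θ, hθdef⟩ : ∃ θ, θ = (curveE' t x).a₄ / σ := ⟨_, rfl⟩
  have ha₄ : (curveE' t x).a₄ = σ * θ := by
    rw [hθdef, mul_div_cancel₀]; rwa [hσ]
  have hM : M = σ := by rw [hσ, e₁]; ring
  have hL : L = ρ - σ := by rw [← hM]; linear_combination -e₂
  have hY : Y ≠ 0 := by
    rintro rfl
    refine d.add_Y_ne_zero k hno hρ (h := hQ) ?_
    rw [← hσ, ← hL, ← hM, ← e₃, neg_zero]
  -- The line through P' and S has slope ρ - σ and intercept σ; comparing a₄ gives x(P' + S) = σz.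
  obtain ⟨z, hz⟩ : ∃ z, z = (θ - 2 * ρ) + 2 * σ := ⟨_, rfl⟩
  have hXz : X = σ * z := by
    have := hl.a₄_eq
    rw [ha₄, hL, hM] at this
    rw [hz]
    linear_combination -this
  rw [← hσ] at nσ hθ h0 ha₆ hsign
  rw [← hθdef] at hsign
  have hσpos := padicNorm_pos (p := 2) h0
  have nθ : padicNorm 2 θ = 1 := by
    rw [hθdef, padicNorm.div, hθ, div_self hσpos.ne']
  have nz : padicNorm 2 z = 1 / 2 := by
    have : padicNorm 2 (2 * σ) < 1 / 2 := by
      rw [padicNorm.mul, padicNorm_two_two]; linarith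
    rw [hz, padicNorm_add_eq_of_lt (by rwa [hsign]), hsign]
  obtain ⟨l, m, X', Y', h', e', f₁, -, hl', -⟩ := hW.exists_double hQ hY
  have heq := (hW.equation_iff _ _).mp hQ.1
  have hX' : 4 ≤ padicNorm 2 X' := by
    refine four_le_padicNorm_double (d.four_a₂_sub_five_le k) h0 nσ nθ nz (w := Y ^ 2) ?_ ?_
    · rw [heq, ha₄, ha₆, hXz]; ring
    · have h1 : X' * (4 * Y ^ 2) = X ^ 4 - 2 * (curveE' t x).a₄ * X ^ 2 -
          8 * (curveE' t x).a₆ * X + (curveE' t x).a₄ ^ 2 -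
          4 * (curveE' t x).a₂ * (curveE' t x).a₆ := by
        rw [hl'.a₂_eq, hl'.a₄_eq, hl'.a₆_eq, f₁]; ring
      rw [h1, ha₄, ha₆, hXz]; ring
  intro hzero
  -- The factor 3 removes S: [3n](P' + S) = [3n]P'.
  refine d.nsmul_ne_zero_of_double k ?_ e' hX' (n := 3 * n) (mul_ne_zero three_ne_zero hn) ?_
  · rw [hθ, ← d.abc, ← hσ]
  · rw [mul_comm, mul_smul, ← e, nsmul_add, h3, add_zero, smul_comm, hzero, nsmul_zero]

/-- When |a₄| = |σ₃|, the units (a₄/σ₃)² and 4a₂ may cancel in 4x([2]P'), so P' is translated by S'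
or -S'. Of a₄/σ₃ ± 2ρ one has norm exactly 1/2, and this selects the sign. -/
theorem nsmul_P_ne_zero_of_eq (d : TripleData t x a b c A B C) (k : TwoAdic t x)
    (hno : ¬ ∃ p, ∃ _ : Fact p.Prime, p ≠ 2 ∧ padicNorm p (t ^ 2 - 1) < 1)
    {hP : (curveE' t x).Nonsingular 0 (a * b * c)} {hS : (curveE' t x).Nonsingular 1 ρ}
    (h3 : 3 • (WeierstrassCurve.Affine.Point.some 1 ρ hS) = 0) (hρ : ρ ^ 2 = (A * B * C) ^ 2)
    (hθ : padicNorm 2 (curveE' t x).a₄ = padicNorm 2 (sigma₃ t)) {n : ℕ} (hn : n ≠ 0) :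
    n • (WeierstrassCurve.Affine.Point.some 0 (a * b * c) hP) ≠ 0 := by
  have n1 : padicNorm 2 ((curveE' t x).a₄ / (a * b * c)) = 1 := by
    rw [padicNorm.div, hθ, ← d.abc, div_self (padicNorm_pos d.abc_ne).ne']
  have n2 : padicNorm 2 (2 * ρ) = 1 := by
    have h1 : padicNorm 2 ((2 * ρ) ^ 2) = 1 := by
      rw [mul_pow, hρ, ← mul_pow, padicNorm_pow, d.padicNorm_two_mul_prod k, one_pow]
    rw [padicNorm_pow] at h1
    exact (pow_eq_one_iff_of_nonneg (padicNorm.nonneg _) two_ne_zero).mp h1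
  rcases padicNorm_two_add_or_sub n1 n2 with h | h
  · obtain ⟨hS', e⟩ := (isShort_curveE' t x).neg_some hS
    refine d.nsmul_P_ne_zero_of_eq_aux k hno (hS := hS') ?_ (by rw [neg_sq, hρ]) hθ ?_ hn
    · rw [← e, neg_nsmul, h3, neg_zero]
    · rwa [mul_neg, sub_neg_eq_add]
  · exact d.nsmul_P_ne_zero_of_eq_aux k hno h3 hρ hθ h hn

end TripleData

/-- For t = u/v in lowest terms, (u-v)(u+v) has no odd prime factor, and it is not ±1 because uv ≠
0. So 2 divides it, and u, v are both odd. -/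
theorem padicNorm_two_of_no_odd_prime {t : ℚ} (ht : t ≠ 0)
    (hno : ¬ ∃ p, ∃ _ : Fact p.Prime, p ≠ 2 ∧ padicNorm p (t ^ 2 - 1) < 1) :
    padicNorm 2 t = 1 := by
  obtain ⟨v, hv⟩ : ∃ v : ℤ, v = (t.den : ℤ) := ⟨_, rfl⟩
  obtain ⟨u, hu⟩ : ∃ u : ℤ, u = t.num := ⟨_, rfl⟩
  have hv0 : v ≠ 0 := by rw [hv]; exact_mod_cast t.den_nz
  have hu0 : u ≠ 0 := by rw [hu]; exact Rat.num_ne_zero.mpr ht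
  have hcop : IsCoprime u v := by
    rw [hu, hv, Int.isCoprime_iff_gcd_eq_one]; exact t.reduced
  have htuv : t * v = u := by
    rw [hu, hv]; push_cast; exact Rat.mul_den_eq_num t
  have hprime : ∀ p : ℕ, p.Prime → (p : ℤ) ∣ (u - v) * (u + v) → p = 2 := by
    intro p hp hdvd
    by_contra hp2
    have hfact := Fact.mk hp
    have hpZ : Prime (p : ℤ) := Nat.prime_iff_prime_int.mp hp
    refine hno ⟨p, hfact, hp2, ?_⟩
    have hpv : ¬ (p : ℤ) ∣ v := by
      intro h
      have h1 : (p : ℤ) ∣ u := by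
        rcases hpZ.dvd_or_dvd hdvd with h2 | h2
        · exact (dvd_sub_left h).mp h2
        · exact (dvd_add_left h).mp h2
      exact hpZ.not_isUnit (hcop.isUnit_of_dvd' h1 h)
    have e : (t ^ 2 - 1) * (v : ℚ) ^ 2 = (((u - v) * (u + v) : ℤ) : ℚ) := by
      push_cast
      rw [← htuv]; ring
    have := congrArg (padicNorm p) e
    rw [padicNorm.mul, padicNorm_pow, (padicNorm.int_eq_one_iff _).mpr hpv, one_pow,
      mul_one] at this
    rw [this]
    exact (padicNorm.int_lt_one_iff _).mpr hdvd
  have hodd : ¬ (2 : ℤ) ∣ u ∧ ¬ (2 : ℤ) ∣ v := by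
    have hk : ((u - v) * (u + v)).natAbs ≠ 1 := by
      intro h
      rw [Int.natAbs_mul, mul_eq_one] at h
      omega
    obtain ⟨p, hp, hpk⟩ := Nat.exists_prime_and_dvd hk
    have hpk' : (p : ℤ) ∣ (u - v) * (u + v) := Int.natCast_dvd.mpr hpk
    obtain rfl := hprime p hp hpk'
    have h2 : ¬ ((2 : ℤ) ∣ u ∧ (2 : ℤ) ∣ v) := fun h =>
      Int.prime_two.not_isUnit (hcop.isUnit_of_dvd' h.1 h.2)
    rcases Int.prime_two.dvd_or_dvd hpk' with h | h <;> omega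
  have n := congrArg (padicNorm 2) htuv
  rwa [padicNorm.mul, (padicNorm.int_eq_one_iff v).mpr (by exact_mod_cast hodd.2),
    (padicNorm.int_eq_one_iff u).mpr (by exact_mod_cast hodd.1), mul_one] at n

namespace TripleData

variable {t x a b c A B C ρ : ℚ}

/-- The point `P'` has infinite order. -/
theorem nsmul_P_ne_zero (d : TripleData t x a b c A B C) (hx0 : x ≠ 0)
    (hx : ∀ p, ∀ _ : Fact p.Prime, p ≠ 2 → padicNorm p (t ^ 2 - 1) < 1 → ¬ padicNorm p (x - 8) < 1)
    {hP : (curveE' t x).Nonsingular 0 (a * b * c)} {hS : (curveE' t x).Nonsingular 1 ρ}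
    (h3 : 3 • (WeierstrassCurve.Affine.Point.some 1 ρ hS) = 0) (hρ : ρ ^ 2 = (A * B * C) ^ 2)
    {n : ℕ} (hn : n ≠ 0) :
    n • (WeierstrassCurve.Affine.Point.some 0 (a * b * c) hP) ≠ 0 := by
  by_cases hno : ∃ p, ∃ _ : Fact p.Prime, p ≠ 2 ∧ padicNorm p (t ^ 2 - 1) < 1
  · obtain ⟨p, hp, hp2, hlt⟩ := hno
    exact d.nsmul_P_ne_zero_of_odd_prime hp2 hlt hx0 (hx p hp hp2 hlt) hn
  · have nt := padicNorm_two_of_no_odd_prime d.t_ne hno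
    have nτ := padicNorm_two_sq_sub_one_le nt
    have ns : padicNorm 2 (t ^ 2 + 1) = 1 / 2 := by
      have : t ^ 2 + 1 = 2 + (t ^ 2 - 1) := by ring
      rw [this, padicNorm_add_eq_of_lt, padicNorm_two_two]
      rw [padicNorm_two_two]
      exact nτ.trans_lt (by norm_num)
    have hq : padicNorm 2 ((t ^ 2 + 1) / (2 * t)) = 1 := by
      rw [padicNorm.div, padicNorm.mul, ns, nt, padicNorm_two_two]; norm_num
    have hσ : padicNorm 2 (sigma₃ t) ≤ 1 / 4 := by
      rw [sigma₃, padicNorm.div, padicNorm.mul, nt, padicNorm_two_two,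
        div_le_iff₀ (by norm_num)]
      linarith
    by_cases hθ : 1 ≤ padicNorm 2 (curveE' t x).a₄
    · refine d.nsmul_P_ne_zero_of_one_le hq ?_ hθ hn
      rw [d.abc]
      exact hσ.trans_lt (by norm_num)
    · have k : TwoAdic t x := ⟨hq, hσ, not_le.mp hθ⟩
      by_cases h : padicNorm 2 (curveE' t x).a₄ = padicNorm 2 (sigma₃ t)
      · exact d.nsmul_P_ne_zero_of_eq k hno h3 hρ h hn
      · exact d.nsmul_P_ne_zero_of_ne k h hn

end TripleData

end DiophantineSextuples

theorem mainTheorem4 (t : ℚ) (ht_neg_one : t ≠ -1) (ht_zero : t ≠ 0) (ht_one : t ≠ 1)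
    (m : ℕ) (hm : 1 < m) :
    -- the multiple `[m]R` is an affine point `[x, y]` with `x ≠ 0`
    ∃ (x y : ℚ) (h : (DiophantineSextuples.curveE t).Nonsingular x y),
      m • DiophantineSextuples.pointR t = .some x y h ∧ x ≠ 0 ∧
      -- the associated `E''` is an elliptic curve with full rational 2-torsion
      (DiophantineSextuples.curveE'' t x).IsElliptic ∧
      DiophantineSextuples.HasFullRationalTwoTorsion (DiophantineSextuples.curveE'' t x) ∧
      -- the associated triple is rational, and it is a rational Diophantine triple
      ∃ a b c : ℚ,
        DiophantineSextuples.tripleCubic t x =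
          (Polynomial.X - Polynomial.C a) * (Polynomial.X - Polynomial.C b) *
            (Polynomial.X - Polynomial.C c) ∧
        DiophantineSextuples.IsRationalDiophantineTuple 3 {a, b, c} ∧
        -- `S' = [1, √((ab+1)(ac+1)(bc+1))]` is a rational point of `E'` with `[3]S' = O`
        ∃ ρ : ℚ, 0 ≤ ρ ∧ ρ ^ 2 = (a * b + 1) * (a * c + 1) * (b * c + 1) ∧
        ∃ (hP : (DiophantineSextuples.curveE' t x).Nonsingular 0 (a * b * c))
          (hS : (DiophantineSextuples.curveE' t x).Nonsingular 1 ρ),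
          3 • (WeierstrassCurve.Affine.Point.some 1 ρ hS) = 0 ∧
          -- all but finitely many odd multiples of `P' = [0, abc]` yield rational Diophantine
          -- sextuples, and infinitely many different ones arise
          {n : ℕ | ¬ DiophantineSextuples.IsRationalDiophantineTuple 6
            (DiophantineSextuples.extendedSet a b c
              ((2 * n + 1) • WeierstrassCurve.Affine.Point.some 0 (a * b * c) hP)
              (WeierstrassCurve.Affine.Point.some 1 ρ hS))}.Finite ∧
          {s : Finset ℚ | DiophantineSextuples.IsRationalDiophantineTuple 6 s ∧
            ∃ n : ℕ, s = DiophantineSextuples.extendedSet a b c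
              ((2 * n + 1) • WeierstrassCurve.Affine.Point.some 0 (a * b * c) hP)
              (WeierstrassCurve.Affine.Point.some 1 ρ hS)}.Infinite := by
  obtain ⟨x, y, h, g, k, e, hx, hy, hc⟩ := DiophantineSextuples.exists_nsmul_pointR ht_zero hm
  obtain ⟨e₁, e₂, e₃, hr, h₁₂, h₁₃, h₂₃⟩ :=
    DiophantineSextuples.hasRoots_curveE'' ht_zero ht_one ht_neg_one hx hy hc
  obtain ⟨a, b, c, A, B, C, d, -, -⟩ :=
    DiophantineSextuples.exists_tripleData ht_zero ht_one ht_neg_one hx hy hc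
  -- The signs of A, B, C are tied by e₂ = 0, so the nonnegative square root is |ABC|.
  have hρ : |A * B * C| ^ 2 = (a * b + 1) * (a * c + 1) * (b * c + 1) := by
    rw [sq_abs, d.ab, d.ac, d.bc]; ring
  have hP := d.nonsingular (X := 0) (Y := a * b * c) (by ring)
  have hS := d.nonsingular (X := 1) (Y := |A * B * C|) (by rw [hρ]; ring)
  have h3 := d.three_nsmul_eq_zero hρ hS
  have hinf : ∀ n : ℕ, n ≠ 0 → n • WeierstrassCurve.Affine.Point.some 0 (a * b * c) hP ≠ 0 :=
    fun n hn => d.nsmul_P_ne_zero hx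
      (fun p _ hp ht => DiophantineSextuples.not_node_of_nsmul_pointR hp ht m x y h e) h3
      (sq_abs _) hn
  exact ⟨x, y, h, e, hx, hr.isElliptic h₁₂ h₁₃ h₂₃, hr.hasFullRationalTwoTorsion h₁₂ h₁₃ h₂₃,
    a, b, c, d.tripleCubic_eq, d.isRationalDiophantineTuple, |A * B * C|, abs_nonneg _, hρ, hP, hS,
    h3, d.finite_not_and_infinite hinf h3⟩
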